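/- Let $G=(V,E)$ be a finite simple undirected graph. For an ordering $\sigma$ of $V$ and $v\in V$ let $p(v,\sigma)$ and $q(v,\sigma)$ be the numbers of neighbours of $v$ that precede, respectively succeed, $v$ in $\sigma$. The imbalance of $\sigma$ is $\mathcal I(\sigma)=\sum_{v\in V}|p(v,\sigma)-q(v,\sigma)|$, and the imbalance of $G$ is $\mathcal I(G)=\min_\sigma \mathcal I(\sigma)$, the minimum over all orderings of $V$. A set $S\subseteq V$ is a twin cover of $G$ if for every connected component $X$ of $G\setminus S$ any two vertices $u,v$ of $X$ satisfy $N[u]=N[v]$, where $N[\cdot]$ is the closed neighbourhood in $G$. Consider the following parameterized problem (Imbalance parameterized by twin cover, with explicit input): given a graph $G$ by its adjacency matrix, a twin cover $S$ of $G$ of size at most $k$, and a target $t\in\mathbb N$ in binary, decide whether $\mathcal I(G)\le t$; the parameter is $k$. Theorem. This problem is in the class XP: there are a single algorithm and computable functions $f,g:\mathbb N\to\mathbb N$ such that, for every input $(x,k)$ with $x\in\{0,1\}^*$ and $k\in\mathbb N$, the algorithm halts after at most $f(k)\cdot(|x|+k+1)^{g(k)}$ steps and accepts if and only if $x$ encodes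 $(G,S,t)$ as above, with $S$ a twin cover of $G$ of size at most $k$ and $\mathcal I(G)\le t$. (Steps are those of a unit-cost random access machine on natural numbers with addition, truncated subtraction and indirect addressing, which is polynomially equivalent to Turing machines.) -/

import Mathlib

/-! ## Imbalance of a graph -/

/-- The predecessors of `v`: neighbours of `v` placed before `v`, where `σ u` is the position of
the vertex `u` in the ordering `σ`. -/
def leftNeighbors {n : ℕ} (G : SimpleGraph (Fin n)) (σ : Equiv.Perm (Fin n)) (v : Fin n) :
    Set (Fin n) :=
  {u | G.Adj v u ∧ σ u < σ v}

/-- The successors of `v`: neighbours of `v` placed after `v`. -/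
def rightNeighbors {n : ℕ} (G : SimpleGraph (Fin n)) (σ : Equiv.Perm (Fin n)) (v : Fin n) :
    Set (Fin n) :=
  {u | G.Adj v u ∧ σ v < σ u}

/-- The imbalance of a vertex: the absolute difference between the numbers of its predecessors
and successors. -/
noncomputable def vertexImbalance {n : ℕ} (G : SimpleGraph (Fin n)) (σ : Equiv.Perm (Fin n))
    (v : Fin n) : ℕ :=
  (((leftNeighbors G σ v).ncard : ℤ) - ((rightNeighbors G σ v).ncard : ℤ)).natAbs

/-- The imbalance of an ordering. -/
noncomputable def orderingImbalance {n : ℕ} (G : SimpleGraph (Fin n)) (σ : Equiv.Perm (Fin n)) :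
    ℕ :=
  ∑ v, vertexImbalance G σ v

/-- The imbalance of a graph: the minimum over all orderings (the set of orderings is finite and
nonempty, so this infimum of natural numbers is a minimum). -/
noncomputable def imbalance {n : ℕ} (G : SimpleGraph (Fin n)) : ℕ :=
  ⨅ σ : Equiv.Perm (Fin n), orderingImbalance G σ

/-! ## Twin covers -/

/-- `Y` is a set of true twins: any two of its vertices have the same closed neighbourhood. -/
def IsTrueTwinSet {V : Type*} (G : SimpleGraph V) (Y : Set V) : Prop :=
  ∀ u ∈ Y, ∀ v ∈ Y, insert u (G.neighborSet u) = insert v (G.neighborSet v)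

/-- `S` is a twin cover: the vertices of every connected component of `G ∖ S` form a set of true
twins in `G`. -/
def IsTwinCover {V : Type*} (G : SimpleGraph V) (S : Set V) : Prop :=
  ∀ X : (G.induce Sᶜ).ConnectedComponent, IsTrueTwinSet G (Subtype.val '' X.supp)

/-! ## Random access machines

Programs of a random access machine with finitely many registers per program and an unbounded
memory that is addressed indirectly.  Registers and memory cells hold natural numbers.  The only
arithmetic is addition and truncated subtraction, so one instruction lengthens the binary
representation of the largest number present by at most one bit; the unit-cost step count is
therefore polynomially related to the running time of Turing machines. -/

namespace RAM

/-- Programs. Arguments are indices of registers, except for the constant `c`. -/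
inductive Prog : Type
  /-- do nothing -/
  | skip : Prog
  /-- `r := c` -/
  | const (r c : ℕ) : Prog
  /-- `r := a` -/
  | copy (r a : ℕ) : Prog
  /-- `r := a + b` -/
  | add (r a b : ℕ) : Prog
  /-- `r := a - b`, and `0` if `a < b` -/
  | sub (r a b : ℕ) : Prog
  /-- `r := memory[a]` -/
  | load (r a : ℕ) : Prog
  /-- `memory[a] := b` -/
  | store (a b : ℕ) : Prog
  /-- first `p`, then `q` -/
  | seq (p q : Prog) : Prog
  /-- if `r ≠ 0` then `p` else `q` -/
  | branch (r : ℕ) (p q : Prog) : Prog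
  /-- while `r ≠ 0` do `p` -/
  | loop (r : ℕ) (p : Prog) : Prog

/-- The contents of the registers and of the memory. -/
structure State where
  reg : ℕ → ℕ
  mem : ℕ → ℕ

def State.setReg (s : State) (r x : ℕ) : State :=
  { s with reg := Function.update s.reg r x }

def State.setMem (s : State) (i x : ℕ) : State :=
  { s with mem := Function.update s.mem i x }

/-- `Exec p s m s'`: started in the state `s`, the program `p` halts in the state `s'` after
exactly `m` steps. Every elementary instruction and every evaluation of a test is one step. -/
inductive Exec : Prog → State → ℕ → State → Prop
  | skip (s : State) : Exec .skip s 1 s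
  | const (r c : ℕ) (s : State) : Exec (.const r c) s 1 (s.setReg r c)
  | copy (r a : ℕ) (s : State) : Exec (.copy r a) s 1 (s.setReg r (s.reg a))
  | add (r a b : ℕ) (s : State) : Exec (.add r a b) s 1 (s.setReg r (s.reg a + s.reg b))
  | sub (r a b : ℕ) (s : State) : Exec (.sub r a b) s 1 (s.setReg r (s.reg a - s.reg b))
  | load (r a : ℕ) (s : State) : Exec (.load r a) s 1 (s.setReg r (s.mem (s.reg a)))
  | store (a b : ℕ) (s : State) : Exec (.store a b) s 1 (s.setMem (s.reg a) (s.reg b))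
  | seq {p q : Prog} {s s' s'' : State} {m m' : ℕ} (hp : Exec p s m s') (hq : Exec q s' m' s'') :
      Exec (.seq p q) s (m + m') s''
  | branch_true {r : ℕ} {p q : Prog} {s s' : State} {m : ℕ} (hr : s.reg r ≠ 0)
      (hp : Exec p s m s') : Exec (.branch r p q) s (m + 1) s'
  | branch_false {r : ℕ} {p q : Prog} {s s' : State} {m : ℕ} (hr : s.reg r = 0)
      (hq : Exec q s m s') : Exec (.branch r p q) s (m + 1) s'
  | loop_done {r : ℕ} {p : Prog} {s : State} (hr : s.reg r = 0) : Exec (.loop r p) s 1 s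
  | loop_next {r : ℕ} {p : Prog} {s s' s'' : State} {m m' : ℕ} (hr : s.reg r ≠ 0)
      (hp : Exec p s m s') (hl : Exec (.loop r p) s' m' s'') :
      Exec (.loop r p) s (m + m' + 1) s''

/-- The machine is deterministic: final state and number of steps are determined by the program
and the initial state. -/
theorem Exec.unique {p : Prog} {s s₁ : State} {m₁ : ℕ} (h₁ : Exec p s m₁ s₁) :
    ∀ {s₂ : State} {m₂ : ℕ}, Exec p s m₂ s₂ → m₁ = m₂ ∧ s₁ = s₂ := by
  induction h₁ with
  | seq _ _ ihp ihq =>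
    rintro _ _ (_ | _ | _ | _ | _ | _ | _ | ⟨hp, hq⟩)
    obtain ⟨rfl, rfl⟩ := ihp hp
    obtain ⟨rfl, rfl⟩ := ihq hq
    exact ⟨rfl, rfl⟩
  | branch_true hr _ ih =>
    intro _ _ h
    cases h with
    | branch_true _ hp => obtain ⟨rfl, rfl⟩ := ih hp; exact ⟨rfl, rfl⟩
    | branch_false hr' _ => exact absurd hr' hr
  | branch_false hr _ ih =>
    intro _ _ h
    cases h with
    | branch_true hr' _ => exact absurd hr hr'
    | branch_false _ hp => obtain ⟨rfl, rfl⟩ := ih hp; exact ⟨rfl, rfl⟩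
  | loop_done hr =>
    intro _ _ h
    cases h with
    | loop_done _ => exact ⟨rfl, rfl⟩
    | loop_next hr' _ _ => exact absurd hr hr'
  | loop_next hr _ _ ihp ihl =>
    intro _ _ h
    cases h with
    | loop_done hr' => exact absurd hr' hr
    | loop_next _ hp hl =>
      obtain ⟨rfl, rfl⟩ := ihp hp
      obtain ⟨rfl, rfl⟩ := ihl hl
      exact ⟨rfl, rfl⟩
  | _ => intro _ _ h; cases h; exact ⟨rfl, rfl⟩

/-- The initial state on input `(x, k)`: the parameter `k` is in register `0`, the length of `x`
is in register `1`, the bits of `x` are in the memory cells `0, 1, …, |x| - 1`, and everything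
else is `0`. -/
def init (x : List Bool) (k : ℕ) : State where
  reg := fun r => if r = 0 then k else if r = 1 then x.length else 0
  mem := fun i => (x.getD i false).toNat

end RAM

/-! ## Slice-wise polynomial problems -/

/-- The class XP of parameterized problems `L ⊆ {0,1}* × ℕ`: there are one algorithm and two
computable functions `f, g` such that the algorithm decides, for every input `(x, k)`, whether
`(x, k) ∈ L` (by leaving `1` in register `0` exactly if so), within `f k * |(x, k)| ^ g k` steps.
The size `|(x, k)|` is `|x| + k`; the `+ 1` only keeps it positive. -/
def InXP (L : Set (List Bool × ℕ)) : Prop :=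
  ∃ (p : RAM.Prog) (f g : ℕ → ℕ), Computable f ∧ Computable g ∧
    ∀ (x : List Bool) (k : ℕ), ∃ (m : ℕ) (s : RAM.State),
      RAM.Exec p (RAM.init x k) m s ∧
      m ≤ f k * (x.length + k + 1) ^ g k ∧
      (s.reg 0 = 1 ↔ (x, k) ∈ L)

/-! ## The problem Imbalance parameterized by twin cover -/

open Classical in
/-- The explicit encoding of `(G, S, t)`: the number `n` of vertices in unary, ended by a `0`; the
adjacency matrix of `G`, row by row; the indicator vector of `S`; the number `t` in binary, least
significant bit first. -/
noncomputable def encodeInstance {n : ℕ} (G : SimpleGraph (Fin n)) (S : Finset (Fin n)) (t : ℕ) :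
    List Bool :=
  List.replicate n true ++ [false] ++
    (List.finRange n).flatMap (fun i => (List.finRange n).map fun j => decide (G.Adj i j)) ++
    (List.finRange n).map (fun i => decide (i ∈ S)) ++
    t.bits

/-- Imbalance, with the graph given explicitly, parameterized by the size `k` of a twin cover:
given a graph `G`, a twin cover `S` of `G` of size at most `k` and a target `t`, is the imbalance
of `G` at most `t`? Words that do not encode such an instance are no-instances. -/
def ImbalanceTwinCover : Set (List Bool × ℕ) :=
  {w | ∃ (n : ℕ) (G : SimpleGraph (Fin n)) (S : Finset (Fin n)) (t : ℕ),
    w.1 = encodeInstance G S t ∧ IsTwinCover G (S : Set (Fin n)) ∧ S.card ≤ w.2 ∧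
      imbalance G ≤ t}

/-!
The vertices outside a twin cover `S` form cliques of true twins, so an ordering is described by
the order of `S` and, for every vertex outside `S`, its level: the number of vertices of `S` before
it. Exchanging twins does not change the imbalance, hence the vertices of a clique may be assumed
to appear in their natural order (`exists_optimal_ordering`), and their levels are then given by
`k` thresholds: the level of `v` is the number of thresholds at most `v`. So `k` digits in a base
`B > n` describe the placement of a clique, and `k` further digits describe the order of `S`.

Fix the order of `S`. The imbalance of a vertex outside `S` depends only on the placement of its own
clique. The imbalance of `s ∈ S` depends on the other vertices only through the number of
neighbours of `s` outside `S` that precede it. Both kinds of data are additive over the cliques: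
they are the digits of a number below `B ^ (k + 1)`, the sum of one contribution for each clique
(`Instance.cliqueCode`, `Instance.Valid.total_eq`). It remains to find out which sums
of contributions occur. With `E = B ^ k` choices for every clique, they are the exponents of
`∏ r, ∑ e < E, Q ^ code r e`, as a polynomial in `Q`. Its value at a power of two
`Q = 2 ^ B ^ 3 > E ^ n` is a natural number whose digits in base `Q` are the coefficients
(`two_pow_le_sum_mod_iff`, `Instance.generating_digit_iff`). It has at most `B ^ (k + 4)` bits, and
is therefore computed by additions in `(|x| + k + 1) ^ O(k)` steps.

This algorithm never writes to the memory. It is an expression built from addition, truncated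
subtraction, case distinctions, reading of input bits and primitive recursion over a fixed number of
rounds, `(|x| + k + 1) ^ (k + 4)`. Functions given by such expressions are computed by programs with
polynomially many steps in the number of rounds (`RAM.Cmp`, `RAM.Cmp.fold`), so that it suffices to
follow the definition of the algorithm by closure properties (`cmpP_accepts`).
-/

/-! ### Executions with a bound on the number of steps -/

namespace RAM

/-- `Runs p s N Q`: started in `s`, the program `p` halts after at most `N` steps, in a state
that satisfies `Q`. -/
def Runs (p : Prog) (s : State) (N : ℕ) (Q : State → Prop) : Prop :=
  ∃ m s', Exec p s m s' ∧ m ≤ N ∧ Q s'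

theorem Runs.mono {p : Prog} {s : State} {N N' : ℕ} {Q Q' : State → Prop} (h : Runs p s N Q)
    (hN : N ≤ N') (hQ : ∀ s', Q s' → Q' s') : Runs p s N' Q' := by
  obtain ⟨m, s', he, hm, hq⟩ := h
  exact ⟨m, s', he, hm.trans hN, hQ _ hq⟩

theorem Runs.seq {p q : Prog} {s : State} {N N' : ℕ} {Q R : State → Prop} (hp : Runs p s N Q)
    (hq : ∀ s', Q s' → Runs q s' N' R) : Runs (.seq p q) s (N + N') R := by
  obtain ⟨m, s', he, hm, h⟩ := hp
  obtain ⟨m', s'', he', hm', h'⟩ := hq s' h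
  exact ⟨m + m', s'', .seq he he', by omega, h'⟩

theorem Runs.const (r c : ℕ) (s : State) : Runs (.const r c) s 1 (· = s.setReg r c) :=
  ⟨1, _, .const r c s, le_rfl, rfl⟩

theorem Runs.copy (r a : ℕ) (s : State) : Runs (.copy r a) s 1 (· = s.setReg r (s.reg a)) :=
  ⟨1, _, .copy r a s, le_rfl, rfl⟩

theorem Runs.add (r a b : ℕ) (s : State) :
    Runs (.add r a b) s 1 (· = s.setReg r (s.reg a + s.reg b)) :=
  ⟨1, _, .add r a b s, le_rfl, rfl⟩

theorem Runs.sub (r a b : ℕ) (s : State) :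
    Runs (.sub r a b) s 1 (· = s.setReg r (s.reg a - s.reg b)) :=
  ⟨1, _, .sub r a b s, le_rfl, rfl⟩

theorem Runs.load (r a : ℕ) (s : State) :
    Runs (.load r a) s 1 (· = s.setReg r (s.mem (s.reg a))) :=
  ⟨1, _, .load r a s, le_rfl, rfl⟩

theorem Runs.branch {r : ℕ} {p q : Prog} {s : State} {N : ℕ} {Q : State → Prop}
    (hp : s.reg r ≠ 0 → Runs p s N Q) (hq : s.reg r = 0 → Runs q s N Q) :
    Runs (.branch r p q) s (N + 1) Q := by
  by_cases h : s.reg r = 0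
  · obtain ⟨m, s', he, hm, h'⟩ := hq h
    exact ⟨m + 1, s', .branch_false h he, by omega, h'⟩
  · obtain ⟨m, s', he, hm, h'⟩ := hp h
    exact ⟨m + 1, s', .branch_true h he, by omega, h'⟩

/-- The rule for loops that count down: `Inv j` holds when `j` rounds are left. -/
theorem Runs.loop {r : ℕ} {p : Prog} {N : ℕ} (Inv : ℕ → State → Prop)
    (hstep : ∀ j s, Inv (j + 1) s → s.reg r ≠ 0 ∧ Runs p s N (Inv j))
    (hdone : ∀ s, Inv 0 s → s.reg r = 0) :
    ∀ j s, Inv j s → Runs (.loop r p) s (j * (N + 1) + 1) (Inv 0)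
  | 0, s, h => ⟨1, s, .loop_done (hdone s h), by omega, h⟩
  | j + 1, s, h => by
    obtain ⟨hr, m, s', he, hm, h'⟩ := hstep j s h
    obtain ⟨m', s'', he', hm', h''⟩ := Runs.loop Inv hstep hdone j s' h'
    exact ⟨m + m' + 1, s'', .loop_next hr he he', by linarith, h''⟩

@[simp] theorem State.setReg_reg (s : State) (r x i : ℕ) :
    (s.setReg r x).reg i = if i = r then x else s.reg i := by
  simp [State.setReg, Function.update_apply]

@[simp] theorem State.setReg_mem (s : State) (r x : ℕ) : (s.setReg r x).mem = s.mem := rfl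

/-! ### Functions computed with polynomially many steps -/

/-- The word `x` and the parameter `k`. -/
abbrev Input : Type := List Bool × ℕ

/-- A context for expressions whose free variables have values in `Γ`: the point `γ : Γ` fixes the
input and the contents of the registers below `size`. The registers `0`, `1`, `2` hold the
parameter, the length of the word and the number `β` of rounds of every loop. -/
structure Ctx (β : Input → ℕ) (Γ : Type) where
  size : ℕ
  base : Γ → Input
  reg : Γ → ℕ → ℕ
  three_le : 3 ≤ size
  reg_zero : ∀ γ, reg γ 0 = (base γ).2
  reg_one : ∀ γ, reg γ 1 = (base γ).1.length
  reg_two : ∀ γ, reg γ 2 = β (base γ)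

namespace Ctx

variable {β : Input → ℕ} {Γ : Type}

/-- The number of rounds of a loop. -/
abbrev lim (c : Ctx β Γ) (γ : Γ) : ℕ := β (c.base γ)

/-- The context of the input alone. -/
def root (β : Input → ℕ) : Ctx β Input where
  size := 3
  base := id
  reg := fun I r => if r = 0 then I.2 else if r = 1 then I.1.length else β I
  three_le := le_rfl
  reg_zero := fun _ => rfl
  reg_one := fun _ => rfl
  reg_two := fun _ => rfl

/-- The context with one more variable, kept in the next register. -/
def push (c : Ctx β Γ) : Ctx β (Γ × ℕ) where
  size := c.size + 1
  base := fun p => c.base p.1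
  reg := fun p r => if r = c.size then p.2 else c.reg p.1 r
  three_le := by have := c.three_le; omega
  reg_zero := fun p => by
    have := c.three_le
    rw [if_neg (by omega), c.reg_zero]
  reg_one := fun p => by
    have := c.three_le
    rw [if_neg (by omega), c.reg_one]
  reg_two := fun p => by
    have := c.three_le
    rw [if_neg (by omega), c.reg_two]

/-- The state `s` holds the values that the context prescribes at `γ`. -/
def Fits (c : Ctx β Γ) (γ : Γ) (s : State) : Prop :=
  (∀ r < c.size, s.reg r = c.reg γ r) ∧ s.mem = fun i => ((c.base γ).1.getD i false).toNat

theorem Fits.congr {c : Ctx β Γ} {γ : Γ} {s s' : State} (h : c.Fits γ s)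
    (hr : ∀ r < c.size, s'.reg r = s.reg r) (hm : s'.mem = s.mem) : c.Fits γ s' :=
  ⟨fun r hlt => (hr r hlt).trans (h.1 r hlt), hm.trans h.2⟩

end Ctx

/-- `F` is computed in the context `c` by programs whose number of steps is polynomial in the
number of rounds of a loop. For every large enough `d` there is a program that leaves the result
in register `d` and changes neither the registers below `d` nor the memory. -/
def Cmp {β : Input → ℕ} {Γ : Type} (c : Ctx β Γ) (F : Γ → ℕ) : Prop :=
  ∀ d, c.size ≤ d → ∃ (p : Prog) (T : Polynomial ℕ), ∀ γ s, c.Fits γ s →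
    Runs p s (T.eval (c.lim γ)) fun s' =>
      s'.mem = s.mem ∧ (∀ r < d, s'.reg r = s.reg r) ∧ s'.reg d = F γ

/-- The predicate `P` is decided in the context `c`, again with polynomially many steps. -/
def CmpP {β : Input → ℕ} {Γ : Type} (c : Ctx β Γ) (P : Γ → Prop) : Prop :=
  ∃ F, Cmp c F ∧ ∀ γ, F γ ≠ 0 ↔ P γ

namespace Cmp

variable {β : Input → ℕ} {Γ : Type} {c : Ctx β Γ} {F G H : Γ → ℕ}

theorem congr (hF : Cmp c F) (h : ∀ γ, F γ = G γ) : Cmp c G := by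
  rwa [← funext h]

theorem const (a : ℕ) : Cmp c fun _ => a := fun d hd =>
  ⟨.const d a, 1, fun γ s _ => (Runs.const d a s).mono (by simp) (by
    rintro _ rfl
    refine ⟨rfl, fun r hr => ?_, by simp⟩
    simp [hr.ne])⟩

theorem register (r : ℕ) (hr : r < c.size) : Cmp c fun γ => c.reg γ r := fun d hd =>
  ⟨.copy d r, 1, fun γ s hs => (Runs.copy d r s).mono (by simp) (by
    rintro _ rfl
    refine ⟨rfl, fun r hr => ?_, by simp [hs.1 r hr]⟩
    simp [hr.ne])⟩

theorem param : Cmp c fun γ => (c.base γ).2 :=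
  (register 0 (by have := c.three_le; omega)).congr c.reg_zero

theorem length : Cmp c fun γ => (c.base γ).1.length :=
  (register 1 (by have := c.three_le; omega)).congr c.reg_one

theorem lim : Cmp c c.lim :=
  (register 2 (by have := c.three_le; omega)).congr c.reg_two

theorem var : Cmp c.push fun p => p.2 :=
  (register (c := c.push) c.size (Nat.lt_succ_self _)).congr fun p => by simp [Ctx.push]

theorem weaken (hF : Cmp c F) : Cmp c.push fun p => F p.1 := fun d hd => by
  have hsz : c.push.size = c.size + 1 := rfl
  obtain ⟨p, T, h⟩ := hF d (by omega)
  refine ⟨p, T, fun γ s hs => h γ.1 s ⟨fun r hr => ?_, hs.2⟩⟩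
  rw [hs.1 r (by omega)]
  simp [Ctx.push, hr.ne]

/-- Two values are computed one after the other and then combined by a short program. -/
theorem binary (hF : Cmp c F) (hG : Cmp c G) (q : ℕ → Prog)
    (hq : ∀ γ s d, c.Fits γ s → c.size ≤ d → s.reg d = F γ → s.reg (d + 1) = G γ →
      Runs (q d) s 1 (· = s.setReg d (H γ))) : Cmp c H := fun d hd => by
  obtain ⟨p₁, T₁, h₁⟩ := hF d hd
  obtain ⟨p₂, T₂, h₂⟩ := hG (d + 1) (by omega)
  refine ⟨.seq p₁ (.seq p₂ (q d)), T₁ + (T₂ + 1), fun γ s hs => ?_⟩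
  rw [Polynomial.eval_add, Polynomial.eval_add, Polynomial.eval_one]
  refine (h₁ γ s hs).seq fun s₁ ⟨hm₁, hr₁, hd₁⟩ => ?_
  have hs₁ := hs.congr (fun r hr => hr₁ r (by omega)) hm₁
  refine (h₂ γ s₁ hs₁).seq fun s₂ ⟨hm₂, hr₂, hd₂⟩ => ?_
  have hs₂ := hs₁.congr (fun r hr => hr₂ r (by omega)) hm₂
  refine (hq γ s₂ d hs₂ hd ((hr₂ d (by omega)).trans hd₁) hd₂).mono le_rfl ?_
  rintro _ rfl
  refine ⟨hm₂.trans hm₁, fun r hr => ?_, by simp⟩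
  rw [State.setReg_reg, if_neg hr.ne, hr₂ r (by omega), hr₁ r hr]

theorem add (hF : Cmp c F) (hG : Cmp c G) : Cmp c fun γ => F γ + G γ :=
  binary hF hG (fun d => .add d d (d + 1)) fun γ s d _ _ h₁ h₂ => by
    rw [← h₁, ← h₂]; exact Runs.add _ _ _ s

theorem sub (hF : Cmp c F) (hG : Cmp c G) : Cmp c fun γ => F γ - G γ :=
  binary hF hG (fun d => .sub d d (d + 1)) fun γ s d _ _ h₁ h₂ => by
    rw [← h₁, ← h₂]; exact Runs.sub _ _ _ s

theorem bit (hF : Cmp c F) : Cmp c fun γ => ((c.base γ).1.getD (F γ) false).toNat :=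
  binary hF (const 0) (fun d => .load d d) fun γ s d hs _ h₁ _ => by
    have := congrFun hs.2 (F γ)
    rw [← this, ← h₁]; exact Runs.load _ _ s

theorem select (hH : Cmp c H) (hF : Cmp c F) (hG : Cmp c G) :
    Cmp c fun γ => if H γ ≠ 0 then F γ else G γ := fun d hd => by
  obtain ⟨p₁, T₁, h₁⟩ := hH d hd
  obtain ⟨p₂, T₂, h₂⟩ := hF d hd
  obtain ⟨p₃, T₃, h₃⟩ := hG d hd
  refine ⟨.seq p₁ (.branch d p₂ p₃), T₁ + (T₂ + T₃ + 1), fun γ s hs => ?_⟩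
  simp only [Polynomial.eval_add, Polynomial.eval_one]
  refine (h₁ γ s hs).seq fun s₁ ⟨hm₁, hr₁, hd₁⟩ => ?_
  have hs₁ := hs.congr (fun r hr => hr₁ r (by omega)) hm₁
  refine Runs.branch (fun h => ?_) fun h => ?_
  · rw [hd₁] at h
    refine (h₂ γ s₁ hs₁).mono (by omega) fun s' ⟨hm, hr, he⟩ =>
      ⟨hm.trans hm₁, fun r h => (hr r h).trans (hr₁ r h), by rw [he, if_pos h]⟩
  · rw [hd₁] at h
    refine (h₃ γ s₁ hs₁).mono (by omega) fun s' ⟨hm, hr, he⟩ =>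
      ⟨hm.trans hm₁, fun r h => (hr r h).trans (hr₁ r h), by rw [he, if_neg (not_not.2 h)]⟩

/-- Primitive recursion over the rounds of a loop. The index and the accumulator occupy the
registers of the two new variables; what was there before is saved and restored. -/
theorem fold {F : Γ → ℕ → ℕ → ℕ} (hG : Cmp c G) (hF : Cmp c.push.push fun p => F p.1.1 p.1.2 p.2) :
    Cmp c fun γ => Nat.rec (G γ) (F γ) (c.lim γ) := fun d hd => by
  have hsz : c.push.push.size = c.size + 2 := rfl
  have h3 := c.three_le
  obtain ⟨p, T, hp⟩ := hG (d + 5) (by omega)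
  obtain ⟨q, U, hq⟩ := hF (d + 5) (by omega)
  set n := c.size with hn
  -- Registers `d + 2` and `d + 3` keep the old contents of `n` and `n + 1`, register `d + 4` counts
  -- the remaining rounds, and `d + 5` is scratch space.
  refine ⟨.seq p (.seq (.copy (d + 2) n) (.seq (.copy (d + 3) (n + 1)) (.seq (.copy (n + 1) (d + 5))
    (.seq (.const n 0) (.seq (.copy (d + 4) 2) (.seq (.loop (d + 4) (.seq q (.seq
    (.copy (n + 1) (d + 5)) (.seq (.const (d + 5) 1) (.seq (.add n n (d + 5))
    (.sub (d + 4) (d + 4) (d + 5))))))) (.seq (.copy (d + 5) (n + 1)) (.seq (.copy n (d + 2))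
    (.seq (.copy (n + 1) (d + 3)) (.copy d (d + 5))))))))))),
    T + (1 + (1 + (1 + (1 + (1 + ((.X * (U + 4 + 1) + 1) + 4)))))), fun γ s hs => ?_⟩
  simp only [Polynomial.eval_add, Polynomial.eval_one, Polynomial.eval_mul, Polynomial.eval_X,
    Polynomial.eval_ofNat]
  refine (hp γ s hs).seq fun s₀ ⟨hm₀, hr₀, hd₀⟩ => ?_
  refine (Runs.copy _ _ s₀).seq ?_; rintro s₁ rfl
  refine (Runs.copy _ _ _).seq ?_; rintro s₁ rfl
  refine (Runs.copy _ _ _).seq ?_; rintro s₁ rfl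
  refine (Runs.const _ _ _).seq ?_; rintro s₁ rfl
  refine (Runs.copy _ _ _).seq ?_; rintro s₁ rfl
  let Inv : ℕ → State → Prop := fun j s' =>
    s'.mem = s.mem ∧ (∀ r < d, r ≠ n → r ≠ n + 1 → s'.reg r = s.reg r) ∧
    s'.reg (d + 2) = s₀.reg n ∧ s'.reg (d + 3) = s₀.reg (n + 1) ∧ s'.reg (d + 4) = j ∧
    j ≤ c.lim γ ∧ s'.reg n = c.lim γ - j ∧
    s'.reg (n + 1) = Nat.rec (G γ) (F γ) (c.lim γ - j)
  refine (Runs.loop (N := U.eval (c.lim γ) + 4) Inv (fun j t ht => ?_) (fun t ht => ht.2.2.2.2.1)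
    (c.lim γ) _ ?_).seq ?_
  · obtain ⟨hm, hr, h2, h3', h4, hj, hi, hacc⟩ := ht
    refine ⟨by omega, ?_⟩
    have ht : c.push.push.Fits ((γ, c.lim γ - (j + 1)),
        Nat.rec (G γ) (F γ) (c.lim γ - (j + 1))) t := by
      refine ⟨fun r hr' => ?_, by rw [hm, hs.2]; rfl⟩
      change t.reg r = if r = n + 1 then _ else if r = n then _ else c.reg γ r
      split_ifs with h h
      · rw [h, hacc]
      · rw [h, hi]
      · rw [hr r (by omega) (by omega) (by omega), hs.1 r (by omega)]
    refine (hq _ t ht).seq fun t' ⟨hm', hr', hd'⟩ => ?_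
    refine (((Runs.copy _ _ t').seq (N' := 3) ?_).mono (by omega) fun _ => id)
    rintro t₁ rfl
    refine ((Runs.const _ _ _).seq (N' := 2) ?_)
    rintro t₁ rfl
    refine ((Runs.add _ _ _ _).seq (N' := 1) ?_)
    rintro t₁ rfl
    refine (Runs.sub _ _ _ _).mono le_rfl ?_
    rintro t₁ rfl
    have e : c.lim γ - j = c.lim γ - (j + 1) + 1 := by omega
    refine ⟨by simp [hm', hm], fun r h₁ h₂ h₃ => ?_, ?_, ?_, ?_, by omega, ?_, ?_⟩
    · simp only [State.setReg_reg, ↓reduceIte]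
      rw [if_neg (by omega), if_neg (by omega), if_neg (by omega), if_neg (by omega),
        hr' r (by omega), hr r h₁ h₂ h₃]
    · simp only [State.setReg_reg, ↓reduceIte]
      rw [if_neg (by omega), if_neg (by omega), if_neg (by omega), if_neg (by omega),
        hr' _ (by omega), h2]
    · simp only [State.setReg_reg, ↓reduceIte]
      rw [if_neg (by omega), if_neg (by omega), if_neg (by omega), if_neg (by omega),
        hr' _ (by omega), h3']
    · simp only [State.setReg_reg, ↓reduceIte]
      rw [if_neg (by omega), if_neg (by omega), if_neg (by omega),
        if_neg (by omega), hr' _ (by omega), h4]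
      rfl
    · simp only [State.setReg_reg, ↓reduceIte]
      rw [if_neg (by omega), if_neg (by omega), if_neg (by omega),
        hr' _ (by omega), hi]
      omega
    · simp only [State.setReg_reg, ↓reduceIte]
      rw [if_neg (by omega), if_neg (by omega), if_neg (by omega), hd', e]
  · refine ⟨by simp [hm₀], fun r h₁ h₂ h₃ => ?_, ?_, ?_, ?_, le_rfl, ?_, ?_⟩
    · simp only [State.setReg_reg]
      rw [if_neg (by omega), if_neg (by omega), if_neg (by omega), if_neg (by omega),
        if_neg (by omega), hr₀ r (by omega)]
    · simp only [State.setReg_reg, ↓reduceIte]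
      rw [if_neg (by omega), if_neg (by omega), if_neg (by omega), if_neg (by omega)]
    · simp only [State.setReg_reg, ↓reduceIte]
      rw [if_neg (by omega), if_neg (by omega), if_neg (by omega),
        if_neg (by omega)]
    · simp only [State.setReg_reg, ↓reduceIte]
      rw [if_neg (by omega), if_neg (by omega), if_neg (by omega),
        if_neg (by omega), hr₀ _ (by omega), hs.1 2 (by omega), c.reg_two]
    · simp only [State.setReg_reg, ↓reduceIte]
      rw [if_neg (by omega)]
      omega
    · simp only [State.setReg_reg, ↓reduceIte]
      rw [if_neg (by omega), if_neg (by omega), if_neg (by omega),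
        if_neg (by omega), hd₀]
      simp
  · intro t ⟨hm, hr, h2, h3', h4, hj, hi, hacc⟩
    refine (((Runs.copy _ _ t).seq (N' := 3) ?_).mono (by omega) fun _ => id)
    rintro t₁ rfl
    refine ((Runs.copy _ _ _).seq (N' := 2) ?_)
    rintro t₁ rfl
    refine ((Runs.copy _ _ _).seq (N' := 1) ?_)
    rintro t₁ rfl
    refine (Runs.copy _ _ _).mono le_rfl ?_
    rintro t₁ rfl
    refine ⟨by simp [hm], fun r h₁ => ?_, ?_⟩
    · simp only [State.setReg_reg, ↓reduceIte]
      rw [if_neg (by omega)]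
      rcases eq_or_ne r (n + 1) with rfl | e₁
      · rw [if_pos rfl, if_neg (by omega), if_neg (by omega), h3', hr₀ _ (by omega)]
      rw [if_neg e₁]
      rcases eq_or_ne r n with rfl | e₂
      · rw [if_pos rfl, if_neg (by omega), h2, hr₀ _ (by omega)]
      · rw [if_neg e₂, if_neg (by omega), hr r h₁ e₂ e₁]
    · simp only [State.setReg_reg, ↓reduceIte]
      rw [if_neg (by omega), if_neg (by omega), hacc]
      rfl

end Cmp

end RAM

/-! ### Closure properties: logic, bounded sums, arithmetic -/

namespace RAM

variable {β : Input → ℕ} {Γ : Type} {c : Ctx β Γ} {F G H : Γ → ℕ} {P Q : Γ → Prop}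

theorem CmpP.congr (hP : CmpP c P) (h : ∀ γ, P γ ↔ Q γ) : CmpP c Q := by
  rwa [← funext fun γ => propext (h γ)]

theorem CmpP.weaken (hP : CmpP c P) : CmpP c.push fun p => P p.1 := by
  obtain ⟨F, hF, h⟩ := hP
  exact ⟨_, hF.weaken, fun γ => h γ.1⟩

theorem Cmp.ite [∀ γ, Decidable (P γ)] (hP : CmpP c P) (hF : Cmp c F) (hG : Cmp c G) :
    Cmp c fun γ => if P γ then F γ else G γ := by
  obtain ⟨K, hK, h⟩ := hP
  exact (hK.select hF hG).congr fun γ => by simp only [h]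

theorem CmpP.lt (hF : Cmp c F) (hG : Cmp c G) : CmpP c fun γ => F γ < G γ :=
  ⟨_, hG.sub hF, fun γ => by omega⟩

theorem CmpP.le (hF : Cmp c F) (hG : Cmp c G) : CmpP c fun γ => F γ ≤ G γ :=
  ⟨_, (hG.add (.const 1)).sub hF, fun γ => by omega⟩

theorem CmpP.not (hP : CmpP c P) : CmpP c fun γ => ¬ P γ := by
  obtain ⟨F, hF, h⟩ := hP
  exact ⟨_, (Cmp.const 1).sub hF, fun γ => by simp only [← h]; omega⟩

theorem CmpP.and (hP : CmpP c P) (hQ : CmpP c Q) : CmpP c fun γ => P γ ∧ Q γ := by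
  obtain ⟨F, hF, h⟩ := hP
  obtain ⟨G, hG, h'⟩ := hQ
  refine ⟨_, hF.select hG (.const 0), fun γ => ?_⟩
  simp only [← h, ← h']
  split_ifs with h₁ <;> simp_all

theorem CmpP.or (hP : CmpP c P) (hQ : CmpP c Q) : CmpP c fun γ => P γ ∨ Q γ :=
  (hP.not.and hQ.not).not.congr fun γ => by tauto

theorem CmpP.imp (hP : CmpP c P) (hQ : CmpP c Q) : CmpP c fun γ => P γ → Q γ :=
  (hP.and hQ.not).not.congr fun γ => by tauto

theorem CmpP.eq (hF : Cmp c F) (hG : Cmp c G) : CmpP c fun γ => F γ = G γ :=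
  ((CmpP.le hF hG).and (CmpP.le hG hF)).congr fun γ => by omega

theorem CmpP.bit (hF : Cmp c F) : CmpP c fun γ => (c.base γ).1.getD (F γ) false = true :=
  ⟨_, hF.bit, fun γ => by simp only [ne_eq, Bool.toNat_eq_zero, Bool.not_eq_false]⟩

theorem Cmp.sum {F : Γ → ℕ → ℕ} (hG : Cmp c G) (hle : ∀ γ, G γ ≤ c.lim γ)
    (hF : Cmp c.push fun p => F p.1 p.2) : Cmp c fun γ => ∑ i ∈ Finset.range (G γ), F γ i := by
  refine (Cmp.fold (F := fun γ i a => if i < G γ then a + F γ i else a) (.const 0)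
    (.ite (.lt (.weaken .var) (.weaken (.weaken hG))) (.add .var (.weaken hF)) .var)).congr
    fun γ => ?_
  have (m : ℕ) : (Nat.rec 0 (fun i a => if i < G γ then a + F γ i else a) m : ℕ) =
      ∑ i ∈ Finset.range (min m (G γ)), F γ i := by
    induction m with
    | zero => simp
    | succ m ih =>
      simp only [ih]
      split_ifs with h
      · rw [min_eq_left h.le, min_eq_left h, Finset.sum_range_succ]
      · rw [min_eq_right (by omega), min_eq_right (by omega)]
  rw [this, min_eq_right (hle γ)]

/-- A bounded sum whose terms need to be computed only for indices below the bound. -/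
theorem Cmp.sum_of_lt {F : Γ → ℕ → ℕ} (hG : Cmp c G) (hle : ∀ γ, G γ ≤ c.lim γ)
    (hF : Cmp c.push fun p => F p.1 (Min.min p.2 (G p.1))) :
    Cmp c fun γ => ∑ i ∈ Finset.range (G γ), F γ i :=
  (Cmp.sum (F := fun γ i => F γ (Min.min i (G γ))) hG hle hF).congr fun γ =>
    Finset.sum_congr rfl fun i hi => by rw [min_eq_left (Finset.mem_range.1 hi).le]

theorem CmpP.ball {P : Γ → ℕ → Prop} (hG : Cmp c G) (hle : ∀ γ, G γ ≤ c.lim γ)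
    (hP : CmpP c.push fun p => P p.1 p.2) : CmpP c fun γ => ∀ i < G γ, P γ i := by
  classical
  refine (CmpP.eq (.sum (F := fun γ i => if P γ i then 0 else 1) hG hle
    (.ite hP (.const 0) (.const 1))) (.const 0)).congr fun γ => ?_
  simp [Finset.sum_eq_zero_iff]

theorem CmpP.bex {P : Γ → ℕ → Prop} (hG : Cmp c G) (hle : ∀ γ, G γ ≤ c.lim γ)
    (hP : CmpP c.push fun p => P p.1 p.2) : CmpP c fun γ => ∃ i < G γ, P γ i :=
  (CmpP.ball (P := fun γ i => ¬ P γ i) hG hle hP.not).not.congr fun γ => by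
    push Not; rfl

/-- A bounded quantifier whose body needs to be decided only for indices below the bound. -/
theorem CmpP.bex_of_lt {P : Γ → ℕ → Prop} (hG : Cmp c G) (hle : ∀ γ, G γ ≤ c.lim γ)
    (hP : CmpP c.push fun p => P p.1 (Min.min p.2 (G p.1))) :
    CmpP c fun γ => ∃ i < G γ, P γ i :=
  (CmpP.bex (P := fun γ i => P γ (Min.min i (G γ))) hG hle hP).congr fun γ =>
    exists_congr fun i => and_congr_right fun hi => by rw [min_eq_left hi.le]

theorem Cmp.min (hF : Cmp c F) (hG : Cmp c G) : Cmp c fun γ => Min.min (F γ) (G γ) :=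
  (hF.sub (hF.sub hG)).congr fun γ => by omega

theorem Cmp.mul (hF : Cmp c F) (hG : Cmp c G) (hle : ∀ γ, G γ ≤ c.lim γ) :
    Cmp c fun γ => F γ * G γ :=
  (Cmp.sum (F := fun γ _ => F γ) hG hle hF.weaken).congr fun γ => by simp [mul_comm]

theorem Cmp.pow (hF : Cmp c F) (hG : Cmp c G) (hF' : ∀ γ, F γ ≤ c.lim γ)
    (hG' : ∀ γ, G γ ≤ c.lim γ) : Cmp c fun γ => F γ ^ G γ := by
  refine (Cmp.fold (F := fun γ i a => if i < G γ then a * F γ else a) (.const 1)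
    (.ite (.lt (.weaken .var) (.weaken (.weaken hG)))
      (.mul .var (.weaken (.weaken hF)) fun γ => hF' γ.1.1) .var)).congr fun γ => ?_
  have (m : ℕ) : (Nat.rec 1 (fun i a => if i < G γ then a * F γ else a) m : ℕ) =
      F γ ^ (Min.min m (G γ)) := by
    induction m with
    | zero => simp
    | succ m ih =>
      simp only [ih]
      split_ifs with h
      · rw [min_eq_left h.le, min_eq_left h, pow_succ]
      · rw [min_eq_right (by omega), min_eq_right (by omega)]
  rw [this, min_eq_right (hG' γ)]

/-- Multiplication by a power of two doubles repeatedly, so that the size of the first factor does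
not matter. -/
theorem Cmp.shift (hF : Cmp c F) (hG : Cmp c G) :
    Cmp c fun γ => F γ * 2 ^ Min.min (G γ) (c.lim γ) := by
  refine (Cmp.fold (F := fun γ i a => if i < G γ then a + a else a) hF
    (.ite (.lt (.weaken .var) (.weaken (.weaken hG))) (.add .var .var) .var)).congr fun γ => ?_
  induction c.lim γ with
  | zero => simp
  | succ m ih =>
    simp only [ih]
    split_ifs with h
    · rw [min_eq_right h.le, min_eq_right h, pow_succ]; ring
    · rw [min_eq_left (by omega), min_eq_left (by omega)]

theorem Cmp.shift_of_le (hF : Cmp c F) (hG : Cmp c G) (hle : ∀ γ, G γ ≤ c.lim γ) :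
    Cmp c fun γ => F γ * 2 ^ G γ :=
  (hF.shift hG).congr fun γ => by rw [min_eq_left (hle γ)]

theorem Cmp.div (hF : Cmp c F) (hG : Cmp c G) (hF' : ∀ γ, F γ ≤ c.lim γ) (hG' : ∀ γ, 0 < G γ) :
    Cmp c fun γ => F γ / G γ := by
  refine (Cmp.sum (F := fun γ i => if G γ * Min.min (i + 1) (c.lim γ) ≤ F γ then 1 else 0) .lim
    (fun _ => le_rfl) (.ite (.le (.mul hG.weaken (.min (.add .var (.const 1)) .lim)
      fun γ => min_le_right _ _) hF.weaken) (.const 1) (.const 0))).congr fun γ => ?_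
  have h : ∀ i ∈ Finset.range (c.lim γ),
      (if G γ * Min.min (i + 1) (c.lim γ) ≤ F γ then 1 else 0) = if i < F γ / G γ then 1 else 0 := by
    intro i hi
    have := Nat.le_div_iff_mul_le (hG' γ) (x := i + 1) (y := F γ)
    simp only [min_eq_left (Nat.succ_le_of_lt (Finset.mem_range.1 hi)), mul_comm (G γ), ← this,
      Nat.succ_le_iff]
  rw [Finset.sum_congr rfl h, ← Finset.card_filter]
  have : {i ∈ Finset.range (c.lim γ) | i < F γ / G γ} = Finset.range (F γ / G γ) := by
    have := Nat.div_le_self (F γ) (G γ)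
    have := hF' γ
    ext i
    simp only [Finset.mem_filter, Finset.mem_range]
    omega
  rw [this, Finset.card_range]

theorem Cmp.mod (hF : Cmp c F) (hG : Cmp c G) (hF' : ∀ γ, F γ ≤ c.lim γ) (hG' : ∀ γ, 0 < G γ) :
    Cmp c fun γ => F γ % G γ :=
  (hF.sub (hG.mul (hF.div hG hF' hG') fun γ => (Nat.div_le_self _ _).trans (hF' γ))).congr
    fun γ => by
      have := Nat.mod_add_div (F γ) (G γ)
      omega

/-- Remove from `w` the binary digits with positions from `m` to `l - 1`, the highest first. -/
def clearHigh (l m w : ℕ) : ℕ :=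
  Nat.rec w (fun i a => if m ≤ l - 1 - i ∧ 2 ^ (l - 1 - i) ≤ a then a - 2 ^ (l - 1 - i) else a) l

theorem clearHigh_eq {l m w : ℕ} (hw : w < 2 ^ l) (hm : m ≤ l) : clearHigh l m w = w % 2 ^ m := by
  have key : ∀ i ≤ l, (Nat.rec w (fun i a => if m ≤ l - 1 - i ∧ 2 ^ (l - 1 - i) ≤ a then
      a - 2 ^ (l - 1 - i) else a) i : ℕ) = w % 2 ^ max m (l - i) := by
    intro i
    induction i with
    | zero =>
      intro _
      rw [Nat.sub_zero, max_eq_right hm]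
      exact (Nat.mod_eq_of_lt hw).symm
    | succ i ih =>
      intro hi
      simp only [ih (by omega)]
      have e : l - (i + 1) = l - 1 - i := by omega
      have e' : l - i = l - 1 - i + 1 := by omega
      by_cases h : m ≤ l - 1 - i
      · rw [e, max_eq_right h, max_eq_right (by omega), e', Nat.mod_pow_succ]
        have := Nat.mod_lt w (Nat.two_pow_pos (l - 1 - i))
        rcases Nat.mod_two_eq_zero_or_one (w / 2 ^ (l - 1 - i)) with h' | h' <;> rw [h']
        · rw [if_neg (by omega)]; simp
        · rw [if_pos (by omega)]; simp
      · rw [if_neg (by tauto), max_eq_left (by omega), max_eq_left (by omega)]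
  rw [clearHigh, key l le_rfl]
  simp

theorem Cmp.clearHigh (hF : Cmp c F) (hG : Cmp c G) :
    Cmp c fun γ => clearHigh (c.lim γ) (G γ) (F γ) := by
  have hpow : Cmp c.push.push fun p => 1 * 2 ^ (c.lim p.1.1 - 1 - p.1.2) :=
    .shift_of_le (c := c.push.push) (.const 1) (.sub (.sub (.weaken (.weaken .lim)) (.const 1))
      (.weaken .var)) fun p => (Nat.sub_le _ _).trans (Nat.sub_le _ _)
  refine (Cmp.fold (F := fun γ i a => if G γ ≤ c.lim γ - 1 - i ∧ 1 * 2 ^ (c.lim γ - 1 - i) ≤ a then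
    a - 1 * 2 ^ (c.lim γ - 1 - i) else a) hF
    (.ite (.and (.le (.weaken (.weaken hG)) (.sub (.sub (.weaken (.weaken .lim)) (.const 1))
      (.weaken .var))) (.le hpow .var)) (.sub .var hpow) .var)).congr fun γ => ?_
  simp only [one_mul]
  rfl

end RAM

/-! ### The algorithm -/

namespace ImbalanceXP

open Finset

/-- A graph on `{0, …, n - 1}` with adjacency relation `A` and a vertex set `S`, both given by
predicates on all natural numbers; `k` is the parameter and `B` the base of the positional
encodings. -/
structure Instance where
  n : ℕ
  k : ℕ
  B : ℕ
  A : ℕ → ℕ → Prop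
  S : ℕ → Prop

namespace Instance

variable (D : Instance)

/-- The digit of `e` at position `j` in base `B`. -/
def digit (j e : ℕ) : ℕ := e / D.B ^ j % D.B

open Classical in
/-- The number of neighbours of `v`. -/
noncomputable def degree (v : ℕ) : ℕ := ∑ u ∈ range D.n, if D.A v u then 1 else 0

open Classical in
/-- The rank of `s` in `S`. -/
noncomputable def rank (s : ℕ) : ℕ := ∑ u ∈ range D.n, if D.S u ∧ u < s then 1 else 0

/-- The position of `s ∈ S` coded by the digits of `a`. Positions order `S`, with ties broken by
the vertex. -/
noncomputable def pos (a s : ℕ) : ℕ := D.digit (D.rank s) a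

open Classical in
/-- The level of a vertex `v ∉ S` coded by the digits of `e`: a vertex of `S` is placed before `v`
exactly if its position is smaller than the level of `v`. Levels do not decrease as
`v` grows. -/
noncomputable def level (e v : ℕ) : ℕ := ∑ j ∈ range D.k, if D.digit j e ≤ v then 1 else 0

open Classical in
/-- The number of neighbours placed before a vertex `v ∉ S` of level `l`. -/
noncomputable def cliqueLeft (a l v : ℕ) : ℕ :=
  ∑ u ∈ range D.n, if D.A v u ∧ (¬ D.S u ∧ u < v ∨ D.S u ∧ D.pos a u < l) then 1 else 0

open Classical in
/-- The contribution of a vertex `v ∉ S` of level `l`: its imbalance as the digit at position `0`,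
and a `1` at the position `rank s + 1` of every neighbour `s ∈ S` that is placed after it. -/
noncomputable def code (a l v : ℕ) : ℕ :=
  (D.degree v).dist (2 * D.cliqueLeft a l v) +
    ∑ s ∈ range D.n, if D.S s ∧ D.A v s ∧ l ≤ D.pos a s then D.B ^ (D.rank s + 1) else 0

/-- `v` belongs to the clique outside `S` whose least vertex is `r`. -/
def InClique (r v : ℕ) : Prop :=
  ¬ D.S r ∧ ¬ D.S v ∧ (r = v ∨ D.A r v) ∧ ∀ u < D.n, u < r → ¬ D.S u → ¬ D.A u r

open Classical in
/-- The contribution of the clique with least vertex `r` if its levels are coded by `e`. -/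
noncomputable def cliqueCode (a r e : ℕ) : ℕ :=
  ∑ v ∈ range D.n, if D.InClique r v then D.code a (D.level e v) v else 0

/-- The generating function of the total contributions, evaluated at `2 ^ B ^ 3`. (The cut-off of
the exponent plays no role for valid instances.) -/
noncomputable def generating (a : ℕ) : ℕ :=
  ∏ r ∈ range D.n, ∑ e ∈ range (D.B ^ D.k),
    2 ^ min (D.B ^ 3 * D.cliqueCode a r e) (D.B ^ (D.k + 4))

open Classical in
/-- The number of neighbours placed before `s ∈ S`, where `x` is the total contribution of the
vertices outside `S`. -/
noncomputable def coverLeft (a x s : ℕ) : ℕ :=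
  D.digit (D.rank s + 1) x + ∑ u ∈ range D.n,
    if D.A s u ∧ D.S u ∧ (D.pos a u < D.pos a s ∨ D.pos a u = D.pos a s ∧ u < s) then 1 else 0

open Classical in
/-- The imbalance of the ordering, where `x` is the total contribution of the vertices outside
`S`. -/
noncomputable def total (a x : ℕ) : ℕ :=
  D.digit 0 x + ∑ s ∈ range D.n,
    if D.S s then (D.degree s).dist (2 * D.coverLeft a x s) else 0

/-- Some positions and levels give an ordering with imbalance at most `t`. The total contribution
`x` occurs if and only if the digit of the generating function at position `x` is nonzero. -/
def Solvable (t : ℕ) : Prop :=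
  ∃ a < D.B ^ D.k, ∃ x < D.B ^ (D.k + 1),
    2 ^ (D.B ^ 3 * x) ≤
      RAM.clearHigh (D.B ^ (D.k + 4)) (D.B ^ 3 * (x + 1)) (D.generating a) ∧
    D.total a x ≤ t

open Classical in
/-- `A` is symmetric and irreflexive on `{0, …, n - 1}`, and `S` is a twin cover with at most `k`
elements. -/
def Valid : Prop :=
  (∀ u < D.n, ¬ D.A u u) ∧ (∀ u < D.n, ∀ v < D.n, D.A u v → D.A v u) ∧
    (∀ u < D.n, ∀ v < D.n, ¬ D.S u → ¬ D.S v → D.A u v →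
      ∀ w < D.n, w ≠ v → D.A u w → D.A v w) ∧
    ∑ u ∈ range D.n, (if D.S u then 1 else 0) ≤ D.k

end Instance

open RAM

/-- The bit of the word at position `i`, `false` beyond the end. -/
abbrev bit (I : Input) (i : ℕ) : Bool := I.1.getD i false

open Classical in
/-- The number of ones at the beginning of the word. -/
noncomputable def numVertices (I : Input) : ℕ :=
  ∑ i ∈ range I.1.length, if ∀ j < I.1.length, j ≤ i → bit I j = true then 1 else 0

/-- The instance that the word encodes, if it encodes one. -/
noncomputable def toInstance (I : Input) : Instance where
  n := numVertices I
  k := I.2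
  B := I.1.length + I.2 + 1
  A := fun u v => bit I (numVertices I + 1 + (u * numVertices I + v)) = true
  S := fun u => bit I (numVertices I + 1 + numVertices I * numVertices I + u) = true

/-- The position of the first bit of the target. -/
noncomputable def headerLength (I : Input) : ℕ :=
  numVertices I + 1 + numVertices I * numVertices I + numVertices I

open Classical in
/-- The target in the word: its bits follow the header, the least significant bit first. -/
noncomputable def target (I : Input) : ℕ :=
  ∑ i ∈ range I.1.length,
    if headerLength I ≤ i ∧ bit I i = true then 2 ^ (i - headerLength I) else 0

/-- The condition tested by the algorithm. The word must be long enough, and the binary expansion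
of the target must not end in a `0`. -/
def Accepts (I : Input) : Prop :=
  headerLength I ≤ I.1.length ∧
    (I.1.length = headerLength I ∨ bit I (I.1.length - 1) = true) ∧
    (toInstance I).Valid ∧ (toInstance I).Solvable (target I)

/-! ### The algorithm runs in polynomially many steps, for a fixed parameter -/

/-- The number of rounds of a loop. It bounds all numbers that are divided or serve as exponents:
for a valid instance, the generating function is less than `2 ^ rounds I`. -/
def rounds (I : Input) : ℕ := (I.1.length + I.2 + 1) ^ (I.2 + 4)

theorem base_le_rounds (I : Input) : I.1.length + I.2 + 1 ≤ rounds I :=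
  Nat.le_self_pow (by omega) _

theorem numVertices_le (I : Input) : numVertices I ≤ I.1.length := by
  classical
  refine (Finset.sum_le_card_nsmul _ _ 1 fun i _ => ?_).trans (by simp)
  split_ifs <;> simp

theorem numVertices_le_rounds (I : Input) : numVertices I ≤ rounds I := by
  have := base_le_rounds I
  have := numVertices_le I
  omega

theorem param_le_rounds (I : Input) : I.2 ≤ rounds I := by
  have := base_le_rounds I
  omega

theorem length_le_rounds (I : Input) : I.1.length ≤ rounds I := by
  have := base_le_rounds I
  omega

theorem pow_le_rounds (I : Input) {j : ℕ} (hj : j ≤ I.2 + 4) :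
    (I.1.length + I.2 + 1) ^ j ≤ rounds I :=
  Nat.pow_le_pow_right (by omega) hj

theorem rank_le (I : Input) (s : ℕ) : (toInstance I).rank s ≤ numVertices I := by
  classical
  refine (Finset.sum_le_card_nsmul _ _ 1 fun i _ => ?_).trans (by simp [toInstance])
  split_ifs <;> simp

theorem rank_lt_rounds (I : Input) (s : ℕ) : (toInstance I).rank s + 1 ≤ rounds I := by
  have := base_le_rounds I
  have := numVertices_le I
  have := rank_le I s
  omega

section

variable {Γ : Type} {c : Ctx rounds Γ} {U V X Y : Γ → ℕ}

theorem cmp_base : Cmp c fun γ => (toInstance (c.base γ)).B :=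
  (Cmp.length.add .param).add (.const 1)

theorem cmp_base_pow (hU : Cmp c U) (hle : ∀ γ, U γ ≤ c.lim γ) :
    Cmp c fun γ => (toInstance (c.base γ)).B ^ U γ :=
  cmp_base.pow hU (fun _ => base_le_rounds _) hle

theorem cmp_numVertices : Cmp c fun γ => numVertices (c.base γ) := by
  classical
  exact .sum .length (fun γ => length_le_rounds _) (.ite (.ball (.weaken .length)
    (fun γ => length_le_rounds _) (.imp (.le .var (.weaken .var)) (.bit .var)))
    (.const 1) (.const 0))

theorem cmpP_adj (hU : Cmp c U) (hV : Cmp c V) :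
    CmpP c fun γ => (toInstance (c.base γ)).A (U γ) (V γ) :=
  .bit ((cmp_numVertices.add (.const 1)).add
    ((hU.mul cmp_numVertices fun _ => numVertices_le_rounds _).add hV))

theorem cmpP_mem (hU : Cmp c U) : CmpP c fun γ => (toInstance (c.base γ)).S (U γ) :=
  .bit (((cmp_numVertices.add (.const 1)).add
    (cmp_numVertices.mul cmp_numVertices fun _ => numVertices_le_rounds _)).add hU)

theorem _root_.RAM.Cmp.sum_vertices {F : Γ → ℕ → ℕ} (hF : Cmp c.push fun p => F p.1 p.2) :
    Cmp c fun γ => ∑ v ∈ range (toInstance (c.base γ)).n, F γ v :=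
  .sum cmp_numVertices (fun _ => numVertices_le_rounds _) hF

theorem _root_.RAM.CmpP.ball_vertices {P : Γ → ℕ → Prop} (hP : CmpP c.push fun p => P p.1 p.2) :
    CmpP c fun γ => ∀ v < (toInstance (c.base γ)).n, P γ v :=
  .ball cmp_numVertices (fun _ => numVertices_le_rounds _) hP

theorem cmp_digit (hU : Cmp c U) (hV : Cmp c V) (hU' : ∀ γ, U γ ≤ c.lim γ)
    (hV' : ∀ γ, V γ ≤ c.lim γ) : Cmp c fun γ => (toInstance (c.base γ)).digit (U γ) (V γ) :=
  (hV.div (cmp_base_pow hU hU') hV' fun _ => Nat.pow_pos (Nat.succ_pos _)).mod cmp_base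
    (fun γ => (Nat.div_le_self _ _).trans (hV' γ)) fun _ => Nat.succ_pos _

open Classical in
theorem cmp_degree (hV : Cmp c V) : Cmp c fun γ => (toInstance (c.base γ)).degree (V γ) :=
  .sum_vertices (.ite (cmpP_adj hV.weaken .var) (.const 1) (.const 0))

open Classical in
theorem cmp_rank (hV : Cmp c V) : Cmp c fun γ => (toInstance (c.base γ)).rank (V γ) :=
  .sum_vertices (.ite (.and (cmpP_mem .var) (.lt .var hV.weaken)) (.const 1) (.const 0))

theorem cmp_pos (hX : Cmp c X) (hX' : ∀ γ, X γ ≤ c.lim γ) (hV : Cmp c V) :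
    Cmp c fun γ => (toInstance (c.base γ)).pos (X γ) (V γ) :=
  cmp_digit (cmp_rank hV) hX (fun _ => (rank_le _ _).trans (numVertices_le_rounds _)) hX'

theorem cmp_level (hY : Cmp c Y) (hY' : ∀ γ, Y γ ≤ c.lim γ) (hV : Cmp c V) :
    Cmp c fun γ => (toInstance (c.base γ)).level (Y γ) (V γ) := by
  classical
  refine .sum_of_lt .param (fun _ => param_le_rounds _) (.ite (.le ?_ hV.weaken)
    (.const 1) (.const 0))
  exact cmp_digit (.min .var (.weaken .param)) hY.weaken
    (fun _ => (min_le_right _ _).trans (param_le_rounds _)) fun _ => hY' _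

theorem cmp_dist (hU : Cmp c U) (hV : Cmp c V) : Cmp c fun γ => (U γ).dist (V γ) :=
  (hU.sub hV).add (hV.sub hU)

theorem cmp_double (hU : Cmp c U) : Cmp c fun γ => 2 * U γ :=
  (hU.add hU).congr fun γ => by ring

open Classical in
theorem cmp_cliqueLeft (hX : Cmp c X) (hX' : ∀ γ, X γ ≤ c.lim γ) (hU : Cmp c U) (hV : Cmp c V) :
    Cmp c fun γ => (toInstance (c.base γ)).cliqueLeft (X γ) (U γ) (V γ) :=
  .sum_vertices (.ite (.and (cmpP_adj hV.weaken .var) (.or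
    (.and (.not (cmpP_mem .var)) (.lt .var hV.weaken))
    (.and (cmpP_mem .var) (.lt (cmp_pos hX.weaken (fun _ => hX' _) .var) hU.weaken))))
    (.const 1) (.const 0))

open Classical in
theorem cmp_code (hX : Cmp c X) (hX' : ∀ γ, X γ ≤ c.lim γ) (hU : Cmp c U) (hV : Cmp c V) :
    Cmp c fun γ => (toInstance (c.base γ)).code (X γ) (U γ) (V γ) :=
  .add (cmp_dist (cmp_degree hV) (cmp_double (cmp_cliqueLeft hX hX' hU hV)))
    (.sum_vertices (.ite (.and (cmpP_mem .var) (.and (cmpP_adj hV.weaken .var)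
      (.le hU.weaken (cmp_pos hX.weaken (fun _ => hX' _) .var))))
      (cmp_base_pow (.add (cmp_rank .var) (.const 1)) fun _ => rank_lt_rounds _ _) (.const 0)))

theorem cmpP_inClique (hU : Cmp c U) (hV : Cmp c V) :
    CmpP c fun γ => (toInstance (c.base γ)).InClique (U γ) (V γ) :=
  .and (.not (cmpP_mem hU)) (.and (.not (cmpP_mem hV)) (.and (.or (.eq hU hV) (cmpP_adj hU hV))
    (.ball_vertices (.imp (.lt .var hU.weaken) (.imp (.not (cmpP_mem .var))
      (.not (cmpP_adj .var hU.weaken)))))))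

open Classical in
theorem cmp_cliqueCode (hX : Cmp c X) (hX' : ∀ γ, X γ ≤ c.lim γ) (hU : Cmp c U) (hY : Cmp c Y)
    (hY' : ∀ γ, Y γ ≤ c.lim γ) :
    Cmp c fun γ => (toInstance (c.base γ)).cliqueCode (X γ) (U γ) (Y γ) :=
  .sum_vertices (.ite (cmpP_inClique hU.weaken .var) (cmp_code hX.weaken (fun _ => hX' _)
    (cmp_level hY.weaken (fun _ => hY' _) .var) .var) (.const 0))

theorem cmp_base_pow_param : Cmp c fun γ => (toInstance (c.base γ)).B ^ (toInstance (c.base γ)).k :=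
  cmp_base_pow .param fun _ => param_le_rounds _

theorem cmp_base_cube : Cmp c fun γ => (toInstance (c.base γ)).B ^ 3 :=
  (((cmp_base.mul cmp_base fun _ => base_le_rounds _).mul cmp_base fun _ => base_le_rounds _)).congr
    fun γ => by ring

theorem cmp_generating (hX : Cmp c X) (hX' : ∀ γ, X γ ≤ c.lim γ) :
    Cmp c fun γ => (toInstance (c.base γ)).generating (X γ) := by
  have hle : ∀ γ, (toInstance (c.base γ)).B ^ (toInstance (c.base γ)).k ≤ c.lim γ :=
    fun γ => pow_le_rounds _ (Nat.le_add_right _ _)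
  refine (Cmp.fold (F := fun γ r a => if r < (toInstance (c.base γ)).n then
    ∑ e ∈ range ((toInstance (c.base γ)).B ^ (toInstance (c.base γ)).k),
      a * 2 ^ min ((toInstance (c.base γ)).cliqueCode (X γ) r e * (toInstance (c.base γ)).B ^ 3)
        (c.lim γ) else a)
    (.const 1) (.ite (.lt (.weaken .var) cmp_numVertices)
      (.sum_of_lt cmp_base_pow_param (fun p => hle p.1.1) (.shift (.weaken .var)
        (.mul ?_ cmp_base_cube fun _ => pow_le_rounds _ (by omega)))) .var)).congr fun γ => ?_
  · exact cmp_cliqueCode (.weaken (.weaken (.weaken hX))) (fun _ => hX' _) (.weaken (.weaken .var))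
      (.min .var (.weaken cmp_base_pow_param)) fun p => (min_le_right _ _).trans (hle p.1.1.1)
  · have (m : ℕ) : (Nat.rec 1 (fun r a => if r < (toInstance (c.base γ)).n then
        ∑ e ∈ range ((toInstance (c.base γ)).B ^ (toInstance (c.base γ)).k),
          a * 2 ^ min ((toInstance (c.base γ)).cliqueCode (X γ) r e *
            (toInstance (c.base γ)).B ^ 3) (c.lim γ) else a) m : ℕ) =
        ∏ r ∈ range (min m (toInstance (c.base γ)).n),
          ∑ e ∈ range ((toInstance (c.base γ)).B ^ (toInstance (c.base γ)).k),
            2 ^ min ((toInstance (c.base γ)).B ^ 3 * (toInstance (c.base γ)).cliqueCode (X γ) r e)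
              (c.lim γ) := by
      induction m with
      | zero => simp
      | succ m ih =>
        simp only [ih]
        split_ifs with h
        · rw [min_eq_left h.le, min_eq_left h, prod_range_succ, ← mul_sum]
          simp only [mul_comm]
        · rw [min_eq_right (by omega), min_eq_right (by omega)]
    rw [this, min_eq_right (show (toInstance (c.base γ)).n ≤ c.lim γ from
      numVertices_le_rounds _)]
    rfl

theorem cmp_total (hX : Cmp c X) (hX' : ∀ γ, X γ ≤ c.lim γ) (hY : Cmp c Y)
    (hY' : ∀ γ, Y γ ≤ c.lim γ) : Cmp c fun γ => (toInstance (c.base γ)).total (X γ) (Y γ) := by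
  classical
  refine .add (cmp_digit (.const 0) hY (fun _ => Nat.zero_le _) hY') (.sum_vertices
    (.ite (cmpP_mem .var) (cmp_dist (cmp_degree .var) (cmp_double
    (.add (cmp_digit (.add (cmp_rank .var) (.const 1)) hY.weaken (fun _ => rank_lt_rounds _ _)
      fun _ => hY' _) (.sum_vertices
      (.ite (.and (cmpP_adj (.weaken .var) .var) (.and (cmpP_mem .var) (.or (.lt ?_ ?_)
        (.and (.eq ?_ ?_) (.lt .var (.weaken .var)))))) (.const 1) (.const 0)))))) (.const 0)))
  all_goals first
    | exact cmp_pos hX.weaken.weaken (fun _ => hX' _) .var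
    | exact cmp_pos hX.weaken.weaken (fun _ => hX' _) (.weaken .var)

theorem cmpP_valid : CmpP c fun γ => (toInstance (c.base γ)).Valid := by
  classical
  exact .and (.ball_vertices (.not (cmpP_adj .var .var)))
    (.and (.ball_vertices (.ball_vertices (.imp (cmpP_adj (.weaken .var) .var)
      (cmpP_adj .var (.weaken .var)))))
    (.and (.ball_vertices (.ball_vertices (.imp (.not (cmpP_mem (.weaken .var)))
      (.imp (.not (cmpP_mem .var)) (.imp (cmpP_adj (.weaken .var) .var)
      (.ball_vertices (.imp (.not (.eq .var (.weaken .var)))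
      (.imp (cmpP_adj (.weaken (.weaken .var)) .var) (cmpP_adj (.weaken .var) .var)))))))))
    (.le (.sum_vertices (.ite (cmpP_mem .var) (.const 1) (.const 0))) .param)))

theorem cmpP_solvable (hU : Cmp c U) :
    CmpP c fun γ => (toInstance (c.base γ)).Solvable (U γ) := by
  have hle (j : ℕ) (hj : j ≤ 4) (γ : Γ) :
      (toInstance (c.base γ)).B ^ ((toInstance (c.base γ)).k + j) ≤ c.lim γ :=
    pow_le_rounds _ (Nat.add_le_add_left hj _)
  have hpow : Cmp c fun γ => (toInstance (c.base γ)).B ^ ((toInstance (c.base γ)).k + 1) :=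
    cmp_base_pow_param.mul cmp_base fun _ => base_le_rounds _
  have hexp (p : (Γ × ℕ) × ℕ) (x : ℕ)
      (hx : x ≤ (toInstance (c.base p.1.1)).B ^ ((toInstance (c.base p.1.1)).k + 1)) :
      (toInstance (c.base p.1.1)).B ^ 3 * x ≤ c.lim p.1.1 := by
    refine (Nat.mul_le_mul_left _ hx).trans ?_
    rw [← pow_add]
    exact pow_le_rounds _ (by change 3 + ((c.base p.1.1).2 + 1) ≤ _; omega)
  have hx : Cmp c.push.push fun p => min p.2 ((toInstance (c.base p.1.1)).B ^
      ((toInstance (c.base p.1.1)).k + 1)) := .min .var (.weaken (.weaken hpow))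
  have ha : Cmp c.push.push fun p => min p.1.2 ((toInstance (c.base p.1.1)).B ^
      (toInstance (c.base p.1.1)).k) :=
    .min (.weaken .var) (.weaken (.weaken cmp_base_pow_param))
  have hx' (p : (Γ × ℕ) × ℕ) := (min_le_right p.2 _).trans (hle 1 (by omega) p.1.1)
  have ha' (p : (Γ × ℕ) × ℕ) := (min_le_right p.1.2 _).trans (hle 0 (by omega) p.1.1)
  have hmul {F : (Γ × ℕ) × ℕ → ℕ} (hF : Cmp c.push.push F) :
      Cmp c.push.push fun p => (toInstance (c.base p.1.1)).B ^ 3 * F p :=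
    (hF.mul cmp_base_cube fun _ => pow_le_rounds _ (by omega)).congr fun p => mul_comm _ _
  refine .bex_of_lt cmp_base_pow_param (hle 0 (by omega)) (.bex_of_lt hpow.weaken
    (fun p => hle 1 (by omega) p.1) (.and (.le ?_ ?_) (.le ?_ hU.weaken.weaken)))
  · exact (Cmp.shift_of_le (.const 1) (hmul hx) fun p => hexp p _ (min_le_right _ _)).congr
      fun _ => one_mul _
  · exact .clearHigh (cmp_generating ha ha') (hmul (.add hx (.const 1)))
  · exact cmp_total ha ha' hx hx'

theorem cmp_headerLength : Cmp c fun γ => headerLength (c.base γ) :=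
  .add (.add (.add cmp_numVertices (.const 1))
    (.mul cmp_numVertices cmp_numVertices fun _ => numVertices_le_rounds _)) cmp_numVertices

theorem cmp_target : Cmp c fun γ => target (c.base γ) := by
  classical
  refine .sum_of_lt .length (fun _ => length_le_rounds _) (.ite (.and
    (.le (.weaken cmp_headerLength) ?_) (.bit ?_)) ((Cmp.shift_of_le (.const 1) (.sub ?_
    (.weaken cmp_headerLength)) fun p => (Nat.sub_le _ _).trans
      ((min_le_right _ _).trans (length_le_rounds _))).congr fun _ => one_mul _) (.const 0))
  all_goals exact .min .var (.weaken .length)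

theorem cmpP_accepts : CmpP c fun γ => Accepts (c.base γ) :=
  .and (.le cmp_headerLength .length) (.and (.or (.eq .length cmp_headerLength)
    (.bit (.sub .length (.const 1)))) (.and cmpP_valid (cmpP_solvable cmp_target)))

end

end ImbalanceXP

/-! ### From polynomially many steps to XP -/

namespace RAM

theorem eval_le_mul_pow (T : Polynomial ℕ) : ∃ C D, ∀ l, 1 ≤ l → T.eval l ≤ C * l ^ D := by
  induction T using Polynomial.induction_on' with
  | add p q hp hq =>
    obtain ⟨C, D, h⟩ := hp
    obtain ⟨C', D', h'⟩ := hq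
    refine ⟨C + C', D + D', fun l hl => ?_⟩
    rw [Polynomial.eval_add, add_mul]
    exact add_le_add
      ((h l hl).trans (Nat.mul_le_mul_left _ (Nat.pow_le_pow_right hl (Nat.le_add_right _ _))))
      ((h' l hl).trans (Nat.mul_le_mul_left _ (Nat.pow_le_pow_right hl (Nat.le_add_left _ _))))
  | monomial n a => exact ⟨a, n, fun l _ => by simp⟩

/-- A predicate that is decided with polynomially many steps in the number of rounds
`(|x| + k + 1) ^ (k + 4)` defines a problem in XP. The number of rounds is computed first, by loops
of `|x| + k + 1` rounds. -/
theorem CmpP.inXP {P : Input → Prop} (hP : CmpP (Ctx.root ImbalanceXP.rounds) P) :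
    InXP {I | P I} := by
  set β : Input → ℕ := fun I => I.1.length + I.2 + 1 with hβ
  have hbase : Cmp (Ctx.root β) β := Cmp.lim
  have hle (γ : Input) : β γ ≤ (Ctx.root β).lim γ := le_rfl
  have hk : Cmp (Ctx.root β) fun I => I.2 := .param
  have hR : Cmp (Ctx.root β) ImbalanceXP.rounds :=
    (((((hbase.pow hk hle fun γ => by
      change γ.2 ≤ γ.1.length + γ.2 + 1; omega).mul hbase hle).mul hbase hle).mul hbase hle).mul
        hbase hle).congr fun γ => by
      simp only [ImbalanceXP.rounds, hβ]; ring
  obtain ⟨F, hF, hFP⟩ := hP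
  obtain ⟨p₁, T₁, h₁⟩ := hR 3 le_rfl
  obtain ⟨p₂, T₂, h₂⟩ := hF 3 le_rfl
  obtain ⟨C₁, D₁, hT₁⟩ := eval_le_mul_pow T₁
  obtain ⟨C₂, D₂, hT₂⟩ := eval_le_mul_pow T₂
  refine ⟨.seq (.add 2 0 1) (.seq (.const 3 1) (.seq (.add 2 2 3) (.seq p₁ (.seq (.copy 2 3)
    (.seq p₂ (.branch 3 (.const 0 1) (.const 0 0))))))), fun _ => C₁ + C₂ + 6,
    fun k => D₁ + (k + 4) * D₂, Computable.const _, ?_, fun x k => ?_⟩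
  · exact (Primrec.nat_add.comp (Primrec.const D₁) (Primrec.nat_mul.comp
      (Primrec.nat_add.comp Primrec.id (Primrec.const 4)) (Primrec.const D₂))).to_comp
  have hrun : Runs (.seq (.add 2 0 1) (.seq (.const 3 1) (.seq (.add 2 2 3) (.seq p₁
      (.seq (.copy 2 3) (.seq p₂ (.branch 3 (.const 0 1) (.const 0 0)))))))) (init x k)
      (1 + (1 + (1 + (T₁.eval (β (x, k)) + (1 + (T₂.eval (ImbalanceXP.rounds (x, k)) + (1 + 1)))))))
      fun s => s.reg 0 = 1 ↔ P (x, k) := by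
    refine (Runs.add _ _ _ _).seq ?_; rintro _ rfl
    refine (Runs.const _ _ _).seq ?_; rintro _ rfl
    refine (Runs.add _ _ _ _).seq ?_; rintro _ rfl
    refine (h₁ (x, k) _ ⟨fun r hr => ?_, rfl⟩).seq ?_
    · change r < 3 at hr
      interval_cases r <;> simp [init, Ctx.root, hβ, add_comm]
    rintro s ⟨hm, hr, h3⟩
    refine (Runs.copy _ _ _).seq ?_; rintro _ rfl
    refine (h₂ (x, k) (s.setReg 2 (s.reg 3)) ⟨fun r hr' => ?_, hm⟩).seq ?_
    · change r < 3 at hr'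
      interval_cases r <;> simp [Ctx.root, h3, hr, init]
    rintro t ⟨-, -, ht⟩
    refine Runs.branch (fun h => (Runs.const _ _ _).mono le_rfl ?_)
      fun h => (Runs.const _ _ _).mono le_rfl ?_
    · rintro _ rfl
      simpa [← hFP, ← ht] using h
    · rintro _ rfl
      simpa [← hFP, ← ht] using h
  obtain ⟨m, s, he, hm, hs⟩ := hrun
  refine ⟨m, s, he, hm.trans ?_, hs⟩
  have hB : 1 ≤ β (x, k) := Nat.succ_pos _
  have e₁ := hT₁ _ hB
  have e₂ := hT₂ (ImbalanceXP.rounds (x, k)) (Nat.pow_pos hB)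
  have e : β (x, k) = x.length + k + 1 := rfl
  rw [ImbalanceXP.rounds, ← pow_mul] at e₂
  rw [e] at e₁ hB
  have l₁ : (x.length + k + 1) ^ D₁ ≤ (x.length + k + 1) ^ (D₁ + (k + 4) * D₂) :=
    Nat.pow_le_pow_right hB (Nat.le_add_right _ _)
  have l₂ : (x.length + k + 1) ^ ((k + 4) * D₂) ≤ (x.length + k + 1) ^ (D₁ + (k + 4) * D₂) :=
    Nat.pow_le_pow_right hB (Nat.le_add_left _ _)
  have l₀ : 1 ≤ (x.length + k + 1) ^ (D₁ + (k + 4) * D₂) := Nat.pow_pos hB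
  have := e₁.trans (Nat.mul_le_mul_left C₁ l₁)
  have := e₂.trans (Nat.mul_le_mul_left C₂ l₂)
  rw [e, ImbalanceXP.rounds]
  simp only at *
  linarith

end RAM

/-! ### Positional encodings and generating functions -/

namespace ImbalanceXP

open Finset

theorem sum_mul_pow_lt {B : ℕ} (f : ℕ → ℕ) (m : ℕ) (hf : ∀ i < m, f i < B) :
    ∑ i ∈ range m, f i * B ^ i < B ^ m := by
  induction m with
  | zero => simp
  | succ m ih =>
    rw [sum_range_succ, pow_succ]
    have h₁ := ih fun i hi => hf i (by omega)
    have h₂ : (f m + 1) * B ^ m ≤ B * B ^ m := Nat.mul_le_mul_right _ (hf m (Nat.lt_succ_self m))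
    linarith

theorem sum_mul_pow_div_mod {B : ℕ} (f : ℕ → ℕ) (m j : ℕ) (hf : ∀ i < m, f i < B) (hj : j < m) :
    (∑ i ∈ range m, f i * B ^ i) / B ^ j % B = f j := by
  induction m generalizing f j with
  | zero => omega
  | succ m ih =>
    have h0 := hf 0 (by omega)
    have e : ∑ i ∈ range (m + 1), f i * B ^ i =
        f 0 + B * ∑ i ∈ range m, f (i + 1) * B ^ i := by
      rw [sum_range_succ', mul_sum, add_comm, pow_zero, mul_one]
      exact congrArg _ (sum_congr rfl fun i _ => by ring)
    rw [e]
    cases j with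
    | zero => simp [Nat.add_mul_mod_self_left, Nat.mod_eq_of_lt h0]
    | succ j =>
      rw [pow_succ', ← Nat.div_div_eq_div_mul, Nat.add_mul_div_left _ _ (by omega),
        Nat.div_eq_of_lt h0, zero_add]
      exact ih (fun i => f (i + 1)) j (fun i hi => hf (i + 1) (by omega)) (by omega)

section

variable {ι : Type*} (Ω : Finset ι) (X : ι → ℕ) {q : ℕ}

theorem sum_two_pow_lt (hq : #Ω < 2 ^ q) {x : ℕ} (hX : ∀ ω ∈ Ω, X ω < x) :
    ∑ ω ∈ Ω, 2 ^ (q * X ω) < 2 ^ (q * x) := by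
  have h : (∑ ω ∈ Ω, 2 ^ (q * X ω)) * 2 ^ q ≤ #Ω * 2 ^ (q * x) := by
    rw [sum_mul, ← smul_eq_mul (#Ω)]
    refine sum_le_card_nsmul _ _ _ fun ω hω => ?_
    rw [← pow_add, ← Nat.mul_succ]
    exact Nat.pow_le_pow_right (by omega) (Nat.mul_le_mul_left q (hX ω hω))
  have h' := Nat.mul_lt_mul_of_pos_right hq (Nat.two_pow_pos (q * x))
  exact lt_of_mul_lt_mul_right ((h.trans_lt h').trans_eq (mul_comm _ _)) (Nat.zero_le _)

/-- If `2 ^ q` exceeds the number of summands, then no carries occur in base `2 ^ q`, and a nonzero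
digit at position `x` of the sum tells that the exponent `x` occurs. -/
theorem two_pow_le_sum_mod_iff (hq : #Ω < 2 ^ q) (x : ℕ) :
    2 ^ (q * x) ≤ (∑ ω ∈ Ω, 2 ^ (q * X ω)) % 2 ^ (q * (x + 1)) ↔ ∃ ω ∈ Ω, X ω = x := by
  have hdvd : 2 ^ (q * (x + 1)) ∣ ∑ ω ∈ Ω with ¬ X ω < x + 1, 2 ^ (q * X ω) :=
    dvd_sum fun ω hω => pow_dvd_pow 2 (Nat.mul_le_mul_left q (by simpa using (mem_filter.1 hω).2))
  have hlt : ∑ ω ∈ Ω with X ω < x + 1, 2 ^ (q * X ω) < 2 ^ (q * (x + 1)) :=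
    sum_two_pow_lt _ X ((card_filter_le _ _).trans_lt hq) fun ω hω => (mem_filter.1 hω).2
  obtain ⟨y, hy⟩ := hdvd
  rw [← sum_filter_add_sum_filter_not Ω (fun ω => X ω < x + 1), hy, Nat.add_mul_mod_self_left,
    Nat.mod_eq_of_lt hlt]
  constructor
  · intro h
    by_contra hne
    refine absurd h (not_le.2 (sum_two_pow_lt _ X ((card_filter_le _ _).trans_lt hq) fun ω hω => ?_))
    rw [mem_filter] at hω
    have : X ω ≠ x := fun h' => hne ⟨ω, hω.1, h'⟩
    omega
  · rintro ⟨ω, hω, rfl⟩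
    exact single_le_sum (f := fun ω => 2 ^ (q * X ω)) (fun _ _ => Nat.zero_le _)
      (mem_filter.2 ⟨hω, Nat.lt_succ_self _⟩)

end

namespace Instance

variable {D : Instance}

theorem generating_digit_iff (hk : D.k < D.B) (hn : D.n < D.B) (a x : ℕ)
    (hx : x < D.B ^ (D.k + 1))
    (hcode : ∀ f : ℕ → ℕ, (∀ r, f r < D.B ^ D.k) →
      ∑ r ∈ range D.n, D.cliqueCode a r (f r) < D.B ^ (D.k + 1)) :
    2 ^ (D.B ^ 3 * x) ≤
        RAM.clearHigh (D.B ^ (D.k + 4)) (D.B ^ 3 * (x + 1)) (D.generating a) ↔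
      ∃ f : ℕ → ℕ, (∀ r, f r < D.B ^ D.k) ∧ ∑ r ∈ range D.n, D.cliqueCode a r (f r) = x := by
  have hE : 0 < D.B ^ D.k := Nat.pow_pos (by omega)
  have hlim : D.B ^ 3 * D.B ^ (D.k + 1) = D.B ^ (D.k + 4) := by rw [← pow_add]; congr 1; omega
  have hsingle : ∀ r ∈ range D.n, ∀ e ∈ range (D.B ^ D.k),
      D.cliqueCode a r e < D.B ^ (D.k + 1) := fun r hr e he =>
    (single_le_sum (f := fun r => D.cliqueCode a r e) (fun _ _ => Nat.zero_le _) hr).trans_lt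
      (hcode (fun _ => e) fun _ => mem_range.1 he)
  have hgen : D.generating a = ∑ f ∈ Fintype.piFinset fun _ : Fin D.n => range (D.B ^ D.k),
      2 ^ (D.B ^ 3 * ∑ r : Fin D.n, D.cliqueCode a r (f r)) := by
    have : D.generating a = ∏ r ∈ range D.n, ∑ e ∈ range (D.B ^ D.k),
        2 ^ (D.B ^ 3 * D.cliqueCode a r e) :=
      prod_congr rfl fun r hr => sum_congr rfl fun e he => by
        rw [min_eq_left]
        rw [← hlim]
        exact Nat.mul_le_mul_left _ (hsingle r hr e he).le
    rw [this, prod_range, prod_univ_sum]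
    refine sum_congr rfl fun f _ => ?_
    rw [mul_sum, prod_pow_eq_pow_sum]
  have hext (f : Fin D.n → ℕ) (hf : f ∈ Fintype.piFinset fun _ : Fin D.n => range (D.B ^ D.k)) :
      ∃ f' : ℕ → ℕ, (∀ r, f' r < D.B ^ D.k) ∧
        ∑ r ∈ range D.n, D.cliqueCode a r (f' r) = ∑ r : Fin D.n, D.cliqueCode a r (f r) := by
    refine ⟨fun r => if h : r < D.n then f ⟨r, h⟩ else 0, fun r => ?_, ?_⟩
    · dsimp only
      split_ifs with h
      · exact mem_range.1 (Fintype.mem_piFinset.1 hf ⟨r, h⟩)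
      · exact hE
    · rw [sum_range]
      simp
  have hcard : #(Fintype.piFinset fun _ : Fin D.n => range (D.B ^ D.k)) < 2 ^ D.B ^ 3 := by
    rw [Fintype.card_piFinset]
    simp only [card_range, prod_const, card_univ, Fintype.card_fin]
    rw [← pow_mul]
    have h1 : D.B ^ (D.k * D.n) ≤ (2 ^ D.B) ^ (D.k * D.n) :=
      Nat.pow_le_pow_left Nat.lt_two_pow_self.le _
    refine h1.trans_lt ?_
    rw [← pow_mul]
    refine Nat.pow_lt_pow_right (by omega) ?_
    have : D.k * D.n < D.B * D.B := Nat.mul_lt_mul'' hk hn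
    calc D.B * (D.k * D.n) < D.B * (D.B * D.B) := Nat.mul_lt_mul_of_pos_left this (by omega)
      _ = D.B ^ 3 := by ring
  rw [RAM.clearHigh_eq, hgen, two_pow_le_sum_mod_iff _ _ hcard]
  · constructor
    · rintro ⟨f, hf, rfl⟩
      exact hext f hf
    · rintro ⟨f, hf, rfl⟩
      exact ⟨fun r => f r, Fintype.mem_piFinset.2 fun r => mem_range.2 (hf r),
        (sum_range fun r => D.cliqueCode a r (f r)).symm⟩
  · rw [hgen, ← hlim]
    refine sum_two_pow_lt _ _ hcard fun f hf => ?_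
    obtain ⟨f', hf', h⟩ := hext f hf
    rw [← h]
    exact hcode f' hf'
  · rw [← hlim]
    exact Nat.mul_le_mul_left _ hx

end Instance

end ImbalanceXP

/-! ### Orderings -/

namespace ImbalanceXP

open Finset

section

variable {n : ℕ} (G : SimpleGraph (Fin n)) (σ : Equiv.Perm (Fin n))

open Classical in
theorem vertexImbalance_eq (v : Fin n) :
    vertexImbalance G σ v = (#{u | G.Adj v u}).dist (2 * #{u | G.Adj v u ∧ σ u < σ v}) := by
  have hl : (leftNeighbors G σ v).ncard = #{u | G.Adj v u ∧ σ u < σ v} := by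
    rw [leftNeighbors, ← Set.ncard_coe_finset]; simp
  have hr : (rightNeighbors G σ v).ncard = #{u | G.Adj v u ∧ σ v < σ u} := by
    rw [rightNeighbors, ← Set.ncard_coe_finset]; simp
  have hd : #{u | G.Adj v u} =
      #{u | G.Adj v u ∧ σ u < σ v} + #{u | G.Adj v u ∧ σ v < σ u} := by
    rw [← card_union_of_disjoint]
    · congr 1
      ext u
      simp only [mem_filter, mem_univ, true_and, mem_union, ← and_or_left]
      exact ⟨fun h => ⟨h, lt_or_gt_of_ne fun e => h.ne (σ.injective e).symm⟩, And.left⟩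
    · rw [disjoint_left]
      intro u h₁ h₂
      simp only [mem_filter, mem_univ, true_and] at h₁ h₂
      exact lt_asymm h₁.2 h₂.2
  rw [vertexImbalance, hl, hr, hd, Nat.dist]
  omega

theorem exists_perm_of_injective (g : Fin n → ℕ) (hg : Function.Injective g) :
    ∃ σ : Equiv.Perm (Fin n), ∀ u v, σ u < σ v ↔ g u < g v := by
  have hm : StrictMono (g ∘ Tuple.sort g) :=
    (Tuple.monotone_sort g).strictMono_of_injective (hg.comp (Tuple.sort g).injective)
  refine ⟨(Tuple.sort g).symm, fun u v => ?_⟩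
  rw [← hm.lt_iff_lt]
  simp

theorem orderingImbalance_of_automorphism (φ : Equiv.Perm (Fin n))
    (hφ : ∀ u v, G.Adj (φ u) (φ v) ↔ G.Adj u v) :
    orderingImbalance G (φ.trans σ) = orderingImbalance G σ := by
  classical
  refine Eq.trans (sum_congr rfl fun v _ => ?_) (Equiv.sum_comp φ (vertexImbalance G σ))
  have h₁ : #{u | G.Adj v u} = #{u | G.Adj (φ v) u} :=
    card_equiv φ fun u => by simp [hφ]
  have h₂ : #{u | G.Adj v u ∧ φ.trans σ u < φ.trans σ v} = #{u | G.Adj (φ v) u ∧ σ u < σ (φ v)} :=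
    card_equiv φ fun u => by rw [mem_filter, mem_filter]; simp [hφ]
  rw [vertexImbalance_eq, vertexImbalance_eq, h₁, h₂]

/-- Among the optimal orderings there is one in which adjacent true twins outside `S` appear in
their natural order: as long as `u < v` are adjacent twins placed in the opposite order, exchanging
them preserves the imbalance and increases `∑ v, v * σ v`. -/
theorem exists_optimal_ordering (S : Fin n → Prop)
    (htwin : ∀ u v, ¬ S u → ¬ S v → G.Adj u v → ∀ w, w ≠ v → G.Adj u w → G.Adj v w) :
    ∃ σ, orderingImbalance G σ = imbalance G ∧
      ∀ u v, ¬ S u → ¬ S v → G.Adj u v → u < v → σ u < σ v := by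
  classical
  obtain ⟨σ₀, h₀⟩ : ∃ σ, orderingImbalance G σ = imbalance G :=
    ciInf_mem fun σ => orderingImbalance G σ
  obtain ⟨σ, hσ, hmax⟩ := exists_max_image
    {σ : Equiv.Perm (Fin n) | orderingImbalance G σ = imbalance G}
    (fun σ => ∑ v : Fin n, (v : ℕ) * (σ v : ℕ)) ⟨σ₀, by simpa using h₀⟩
  have hσ' : orderingImbalance G σ = imbalance G := by simpa using hσ
  refine ⟨σ, hσ', fun u v hu hv huv hlt => ?_⟩
  by_contra hle
  have hlt' : σ v < σ u :=
    lt_of_le_of_ne (not_lt.1 hle) fun e => hlt.ne (σ.injective e).symm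
  have hswap : ∀ x y, G.Adj x y → G.Adj (Equiv.swap u v x) (Equiv.swap u v y) := by
    intro x y hxy
    have h₁ := htwin u v hu hv huv
    have h₂ := htwin v u hv hu huv.symm
    have e := hxy.ne
    rcases eq_or_ne x u with rfl | hxu
    · rw [Equiv.swap_apply_left]
      rcases eq_or_ne y v with rfl | hyv
      · rw [Equiv.swap_apply_right]; exact hxy.symm
      · rw [Equiv.swap_apply_of_ne_of_ne e.symm hyv]; exact h₁ y hyv hxy
    rcases eq_or_ne x v with rfl | hxv
    · rw [Equiv.swap_apply_right]
      rcases eq_or_ne y u with rfl | hyu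
      · rw [Equiv.swap_apply_left]; exact hxy.symm
      · rw [Equiv.swap_apply_of_ne_of_ne hyu e.symm]; exact h₂ y hyu hxy
    rw [Equiv.swap_apply_of_ne_of_ne hxu hxv]
    rcases eq_or_ne y u with rfl | hyu
    · rw [Equiv.swap_apply_left]; exact (h₁ x hxv hxy.symm).symm
    rcases eq_or_ne y v with rfl | hyv
    · rw [Equiv.swap_apply_right]; exact (h₂ x hxu hxy.symm).symm
    rwa [Equiv.swap_apply_of_ne_of_ne hyu hyv]
  have hle := hmax ((Equiv.swap u v).trans σ) (by
    rw [mem_filter, orderingImbalance_of_automorphism]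
    · exact ⟨mem_univ _, hσ'⟩
    · exact fun x y => ⟨fun h => by simpa using hswap _ _ h, hswap x y⟩)
  have hsplit (f : Fin n → ℕ) : ∑ w, f w = f u + (f v + ∑ w ∈ (univ.erase u).erase v, f w) := by
    rw [add_sum_erase _ _ (mem_erase.2 ⟨hlt.ne', mem_univ _⟩), add_sum_erase _ _ (mem_univ _)]
  have hrest : ∑ w ∈ (univ.erase u).erase v, (w : ℕ) * ((Equiv.swap u v).trans σ w : ℕ) =
      ∑ w ∈ (univ.erase u).erase v, (w : ℕ) * (σ w : ℕ) :=
    sum_congr rfl fun w hw => by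
      simp only [mem_erase, mem_univ, and_true] at hw
      simp [Equiv.swap_apply_of_ne_of_ne hw.2 hw.1]
  rw [hsplit, hsplit, hrest] at hle
  simp only [Equiv.trans_apply, Equiv.swap_apply_left, Equiv.swap_apply_right] at hle
  have h₁ : (u : ℕ) < v := hlt
  have h₂ : (σ v : ℕ) < σ u := hlt'
  nlinarith

end

end ImbalanceXP

/-! ### The cliques outside `S` -/

namespace ImbalanceXP

open Finset

namespace Instance

variable {D : Instance}

theorem Valid.adj_of_inClique (hV : D.Valid) {r u v : ℕ} (hr : r < D.n) (hu : u < D.n) (hv : v < D.n)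
    (hru : D.InClique r u) (hrv : D.InClique r v) (huv : u ≠ v) : D.A u v := by
  obtain ⟨-, hs, ht, -⟩ := hV
  obtain ⟨hSr, hSu, rfl | hu', -⟩ := hru
  · exact hrv.2.2.1.resolve_left huv
  · rcases hrv.2.2.1 with rfl | hv'
    · exact hs _ hr _ hu hu'
    · exact ht r hr u hu hSr hSu hu' v hv huv.symm hv'

theorem Valid.inClique_unique (hV : D.Valid) {r r' v : ℕ} (hr : r < D.n) (hr' : r' < D.n)
    (hv : v < D.n) (h : D.InClique r v) (h' : D.InClique r' v) : r = r' := by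
  wlog hlt : r < r' generalizing r r'
  · rcases eq_or_ne r r' with e | e
    · exact e
    · exact (this hr' hr h' h (by omega)).symm
  refine absurd ?_ (h'.2.2.2 r hr hlt h.1)
  obtain ⟨-, hs, ht, -⟩ := hV
  obtain ⟨hSr, hSv, e | hrv, -⟩ := h
  · subst e
    exact hs _ hr' _ hr (h'.2.2.1.resolve_left hlt.ne')
  · rcases h'.2.2.1 with e | hrv'
    · exact e ▸ hrv
    · exact ht v hv r hr hSv hSr (hs _ hr _ hv hrv) r' hr' hlt.ne' (hs _ hr' _ hv hrv')

theorem Valid.exists_inClique (hV : D.Valid) {v : ℕ} (hv : v < D.n) (hSv : ¬ D.S v) :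
    ∃ r < D.n, D.InClique r v := by
  classical
  have hex : ∃ r, ¬ D.S r ∧ r < D.n ∧ (r = v ∨ D.A r v) := ⟨v, hSv, hv, .inl rfl⟩
  obtain ⟨hSr, hr, hrv⟩ := Nat.find_spec hex
  refine ⟨Nat.find hex, hr, hSr, hSv, hrv, fun u hu hlt hSu huA => ?_⟩
  refine Nat.find_min hex hlt ⟨hSu, hu, ?_⟩
  obtain ⟨-, hs, ht, -⟩ := hV
  rcases hrv with e | hrv
  · rw [e] at huA
    exact .inr huA
  · by_cases e : u = v
    · exact .inl e
    · exact .inr (hs _ hv _ hu (ht _ hr v hv hSr hSv hrv u hu e (hs _ hu _ hr huA)))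

/-! ### Numbers with one digit for each vertex of `S` -/

theorem rank_lt_rank {s s' : ℕ} (hs : s < D.n) (hS : D.S s) (hlt : s < s') :
    D.rank s < D.rank s' := by
  classical
  refine sum_lt_sum (fun u _ => ?_) ⟨s, mem_range.2 hs, ?_⟩
  · split_ifs with h₁ h₂ <;> first | omega | exact absurd ⟨h₁.1, h₁.2.trans hlt⟩ h₂
  · rw [if_neg (by simp), if_pos ⟨hS, hlt⟩]
    exact Nat.one_pos

theorem rank_injOn {s s' : ℕ} (hs : s < D.n) (hs' : s' < D.n) (hS : D.S s) (hS' : D.S s')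
    (h : D.rank s = D.rank s') : s = s' := by
  rcases lt_trichotomy s s' with hlt | e | hlt
  · exact absurd h (rank_lt_rank hs hS hlt).ne
  · exact e
  · exact absurd h (rank_lt_rank hs' hS' hlt).ne'

theorem Valid.rank_lt (hV : D.Valid) {s : ℕ} (hs : s < D.n) (hS : D.S s) : D.rank s < D.k := by
  classical
  refine (sum_lt_sum (fun u _ => ?_) ⟨s, mem_range.2 hs, ?_⟩).trans_le hV.2.2.2
  · split_ifs with h₁ h₂ <;> first | omega | exact absurd h₁.1 h₂
  · rw [if_neg (by simp), if_pos hS]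
    exact Nat.one_pos

open Classical in
/-- The number with digit `c s` at position `rank s`, for `s ∈ S`. -/
noncomputable def encode (D : Instance) (c : ℕ → ℕ) : ℕ :=
  ∑ s ∈ range D.n, if D.S s then c s * D.B ^ D.rank s else 0

open Classical in
theorem Valid.encode_eq (hV : D.Valid) (c : ℕ → ℕ) :
    D.encode c = ∑ i ∈ range D.k,
      (∑ s ∈ range D.n, if D.S s ∧ D.rank s = i then c s else 0) * D.B ^ i := by
  simp only [sum_mul]
  rw [sum_comm]
  refine sum_congr rfl fun s hs => ?_
  by_cases hS : D.S s
  · rw [if_pos hS, sum_eq_single (D.rank s)]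
    · simp [hS]
    · intro i _ hi
      rw [if_neg (fun h => hi h.2.symm), zero_mul]
    · exact fun h => absurd (mem_range.2 (hV.rank_lt (mem_range.1 hs) hS)) h
  · simp [hS]

open Classical in
theorem fiber_eq (c : ℕ → ℕ) {s : ℕ} (hs : s < D.n) (hS : D.S s) :
    (∑ s' ∈ range D.n, if D.S s' ∧ D.rank s' = D.rank s then c s' else 0) = c s := by
  rw [sum_eq_single s]
  · simp [hS]
  · intro s' hs' hne
    rw [if_neg]
    exact fun h => hne (rank_injOn (mem_range.1 hs') hs h.1 hS h.2)
  · exact fun h => absurd (mem_range.2 hs) h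

open Classical in
theorem fiber_lt {c : ℕ → ℕ} (hc : ∀ s, c s < D.B) (i : ℕ) :
    (∑ s ∈ range D.n, if D.S s ∧ D.rank s = i then c s else 0) < D.B := by
  by_cases h : ∃ s < D.n, D.S s ∧ D.rank s = i
  · obtain ⟨s, hs, hS, rfl⟩ := h
    rw [fiber_eq c hs hS]
    exact hc s
  · rw [sum_eq_zero]
    · exact (Nat.zero_le _).trans_lt (hc 0)
    · intro s hs
      exact if_neg fun h' => h ⟨s, mem_range.1 hs, h'⟩

theorem Valid.encode_lt (hV : D.Valid) {c : ℕ → ℕ} (hc : ∀ s, c s < D.B) :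
    D.encode c < D.B ^ D.k := by
  rw [hV.encode_eq]
  exact sum_mul_pow_lt _ _ fun i _ => fiber_lt hc i

theorem Valid.digit_encode (hV : D.Valid) {c : ℕ → ℕ} (hc : ∀ s, c s < D.B) {s : ℕ}
    (hs : s < D.n) (hS : D.S s) : D.digit (D.rank s) (D.encode c) = c s := by
  rw [hV.encode_eq, digit, sum_mul_pow_div_mod _ _ _ (fun i _ => fiber_lt hc i) (hV.rank_lt hs hS),
    fiber_eq c hs hS]

/-! ### The total contribution of the vertices outside `S` -/

/-- The order relation between adjacent vertices, for positions coded by `a` and levels `l`. -/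
def Before (D : Instance) (a : ℕ) (l : ℕ → ℕ) (u v : ℕ) : Prop :=
  ¬ D.S u ∧ ¬ D.S v ∧ u < v ∨ D.S u ∧ ¬ D.S v ∧ D.pos a u < l v ∨
    ¬ D.S u ∧ D.S v ∧ l u ≤ D.pos a v ∨
    D.S u ∧ D.S v ∧ (D.pos a u < D.pos a v ∨ D.pos a u = D.pos a v ∧ u < v)

open Classical in
/-- The number of neighbours placed before `v`. -/
noncomputable def leftDegree (D : Instance) (a : ℕ) (l : ℕ → ℕ) (v : ℕ) : ℕ :=
  ∑ u ∈ range D.n, if D.A v u ∧ D.Before a l u v then 1 else 0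

theorem leftDegree_le (a : ℕ) (l : ℕ → ℕ) (v : ℕ) : D.leftDegree a l v ≤ D.degree v := by
  classical
  refine sum_le_sum fun u _ => ?_
  split_ifs with h₁ h₂ <;> first | omega | exact absurd h₁.1 h₂

theorem degree_le (v : ℕ) : D.degree v ≤ D.n := by
  classical
  refine (sum_le_card_nsmul _ _ 1 fun i _ => ?_).trans (by simp)
  split_ifs <;> simp

open Classical in
/-- The number of neighbours outside `S` that are placed before `s ∈ S`. -/
noncomputable def cliqueCount (D : Instance) (a : ℕ) (l : ℕ → ℕ) (s : ℕ) : ℕ :=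
  ∑ v ∈ range D.n, if ¬ D.S v ∧ D.A s v ∧ l v ≤ D.pos a s then 1 else 0

theorem cliqueCount_le (a : ℕ) (l : ℕ → ℕ) (s : ℕ) : D.cliqueCount a l s ≤ D.n := by
  classical
  refine (sum_le_card_nsmul _ _ 1 fun i _ => ?_).trans (by simp)
  split_ifs <;> simp

theorem cliqueLeft_eq (a : ℕ) (l : ℕ → ℕ) {v : ℕ} (hS : ¬ D.S v) :
    D.cliqueLeft a (l v) v = D.leftDegree a l v := by
  classical
  refine sum_congr rfl fun u _ => ?_
  congr 1
  simp only [Before, hS, eq_iff_iff]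
  tauto

open Classical in
theorem Valid.sum_cliqueCode (hV : D.Valid) (a : ℕ) (f l : ℕ → ℕ)
    (hl : ∀ r < D.n, ∀ v < D.n, D.InClique r v → D.level (f r) v = l v) :
    ∑ r ∈ range D.n, D.cliqueCode a r (f r) =
      (∑ v ∈ range D.n, if D.S v then 0 else (D.degree v).dist (2 * D.leftDegree a l v)) +
        D.B * D.encode (D.cliqueCount a l) := by
  have h₁ : ∑ r ∈ range D.n, D.cliqueCode a r (f r) =
      ∑ v ∈ range D.n, if D.S v then 0 else D.code a (l v) v := by
    simp only [cliqueCode]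
    rw [sum_comm]
    refine sum_congr rfl fun v hv => ?_
    have hv' := mem_range.1 hv
    split_ifs with hS
    · exact sum_eq_zero fun r _ => if_neg fun h => h.2.1 hS
    · obtain ⟨r, hr, hrv⟩ := hV.exists_inClique hv' hS
      rw [sum_eq_single r]
      · rw [if_pos hrv, hl r hr v hv' hrv]
      · intro r' hr' hne
        exact if_neg fun h => hne (hV.inClique_unique (mem_range.1 hr') hr hv' h hrv)
      · exact fun h => absurd (mem_range.2 hr) h
  have h₂ : D.B * D.encode (D.cliqueCount a l) = ∑ v ∈ range D.n, if D.S v then 0 else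
      ∑ s ∈ range D.n, if D.S s ∧ D.A v s ∧ l v ≤ D.pos a s then D.B ^ (D.rank s + 1) else 0 := by
    have (v : ℕ) : (if D.S v then 0 else ∑ s ∈ range D.n,
        if D.S s ∧ D.A v s ∧ l v ≤ D.pos a s then D.B ^ (D.rank s + 1) else 0) =
        ∑ s ∈ range D.n, if D.S v then 0 else
          if D.S s ∧ D.A v s ∧ l v ≤ D.pos a s then D.B ^ (D.rank s + 1) else 0 := by
      split_ifs <;> simp
    simp only [this]
    rw [sum_comm, encode, mul_sum]
    refine sum_congr rfl fun s hs => ?_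
    by_cases hS : D.S s
    · rw [if_pos hS, cliqueCount, sum_mul, mul_sum]
      refine sum_congr rfl fun v hv => ?_
      have hsym : D.A s v ↔ D.A v s :=
        ⟨hV.2.1 _ (mem_range.1 hs) _ (mem_range.1 hv), hV.2.1 _ (mem_range.1 hv) _ (mem_range.1 hs)⟩
      by_cases hv' : D.S v <;> by_cases h : D.A v s ∧ l v ≤ D.pos a s <;>
        simp [hS, hv', h, hsym, pow_succ']
    · simp [hS]
  rw [h₁, h₂, ← sum_add_distrib]
  refine sum_congr rfl fun v _ => ?_
  split_ifs with hS
  · rfl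
  · rw [code, cliqueLeft_eq a l hS]

open Classical in
/-- The total contribution `x` of the vertices outside `S` determines the imbalance of the ordering
together with the positions. -/
theorem Valid.total_eq (hV : D.Valid) (hB : D.n * D.n < D.B) (hn : D.n < D.B) (a : ℕ)
    (f l : ℕ → ℕ) (hl : ∀ r < D.n, ∀ v < D.n, D.InClique r v → D.level (f r) v = l v) :
    ∑ r ∈ range D.n, D.cliqueCode a r (f r) < D.B ^ (D.k + 1) ∧
    D.total a (∑ r ∈ range D.n, D.cliqueCode a r (f r)) =
      ∑ v ∈ range D.n, (D.degree v).dist (2 * D.leftDegree a l v) := by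
  rw [hV.sum_cliqueCode a f l hl]
  set C := ∑ v ∈ range D.n, if D.S v then 0 else (D.degree v).dist (2 * D.leftDegree a l v)
    with hC
  have hC' : C < D.B := by
    refine lt_of_le_of_lt ((sum_le_card_nsmul _ _ D.n fun v _ => ?_).trans (by simp)) hB
    have h₁ := leftDegree_le (D := D) a l v
    have h₂ := degree_le (D := D) v
    split_ifs
    · exact Nat.zero_le _
    · rw [Nat.dist]; omega
  have hc (s : ℕ) : D.cliqueCount a l s < D.B := (cliqueCount_le a l s).trans_lt hn
  have hE := hV.encode_lt hc
  constructor
  · have : D.B * (D.encode (D.cliqueCount a l) + 1) ≤ D.B * D.B ^ D.k :=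
      Nat.mul_le_mul_left _ hE
    rw [pow_succ']
    linarith
  · have h0 : D.digit 0 (C + D.B * D.encode (D.cliqueCount a l)) = C := by
      rw [digit, pow_zero, Nat.div_one, Nat.add_mul_mod_self_left, Nat.mod_eq_of_lt hC']
    have hs (s : ℕ) (h : s < D.n) (hS : D.S s) :
        D.digit (D.rank s + 1) (C + D.B * D.encode (D.cliqueCount a l)) = D.cliqueCount a l s := by
      rw [← hV.digit_encode hc h hS, digit, pow_succ', ← Nat.div_div_eq_div_mul,
        Nat.add_mul_div_left _ _ (by omega), Nat.div_eq_of_lt hC', zero_add, digit]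
    rw [total, h0, hC, ← sum_add_distrib]
    refine sum_congr rfl fun s hs' => ?_
    by_cases hS : D.S s
    · rw [if_pos hS, if_pos hS, zero_add, coverLeft, hs s (mem_range.1 hs') hS]
      congr 2
      rw [cliqueCount, ← sum_add_distrib]
      refine sum_congr rfl fun u _ => ?_
      by_cases hu : D.S u <;> simp [Before, hS, hu]
    · rw [if_neg hS, if_neg hS, add_zero]

end Instance

end ImbalanceXP

/-! ### Correctness on valid instances -/

namespace ImbalanceXP

open Finset

namespace Instance

variable {D : Instance} {G : SimpleGraph (Fin D.n)}

theorem orderingImbalance_eq (hA : ∀ u v : Fin D.n, D.A u v ↔ G.Adj u v)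
    (σ : Equiv.Perm (Fin D.n)) (a : ℕ) (l : ℕ → ℕ)
    (h : ∀ u v : Fin D.n, G.Adj v u → (σ u < σ v ↔ D.Before a l u v)) :
    orderingImbalance G σ = ∑ v ∈ range D.n, (D.degree v).dist (2 * D.leftDegree a l v) := by
  classical
  rw [sum_range, orderingImbalance]
  refine sum_congr rfl fun v _ => ?_
  rw [vertexImbalance_eq, degree, leftDegree, sum_range, sum_range, card_filter, card_filter]
  congr 2
  · funext u
    simp only [hA]
  · refine sum_congr rfl fun u _ => ?_
    simp only [hA]
    congr 1
    exact propext (and_congr_right fun huv => h u v huv)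

/-- Any choice of digits assigns levels to the vertices outside `S`, each of which lies in a unique
clique. -/
theorem Valid.exists_level (hV : D.Valid) (f : ℕ → ℕ) : ∃ l : ℕ → ℕ, ∀ r < D.n, ∀ v < D.n,
    D.InClique r v → D.level (f r) v = l v := by
  classical
  refine ⟨fun v => if h : ∃ r < D.n, D.InClique r v then D.level (f h.choose) v else 0,
    fun r hr v hv hrv => ?_⟩
  have hex : ∃ r < D.n, D.InClique r v := ⟨r, hr, hrv⟩
  dsimp only
  rw [dif_pos hex, ← hV.inClique_unique hr hex.choose_spec.1 hv hrv hex.choose_spec.2]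

theorem Valid.imbalance_le (hV : D.Valid) (hA : ∀ u v : Fin D.n, D.A u v ↔ G.Adj u v)
    (hB : D.n * D.n < D.B) (hn : D.n < D.B) (hk : D.k < D.B) {t : ℕ} (h : D.Solvable t) :
    imbalance G ≤ t := by
  classical
  obtain ⟨a, -, x, hx, hgen, ht⟩ := h
  rw [generating_digit_iff hk hn a x hx fun f _ => by
    obtain ⟨l, hl⟩ := hV.exists_level f
    exact (hV.total_eq hB hn a f l hl).1] at hgen
  obtain ⟨f, -, rfl⟩ := hgen
  obtain ⟨l, hl⟩ := hV.exists_level f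
  rw [(hV.total_eq hB hn a f l hl).2] at ht
  have hmono : ∀ u < D.n, ∀ v < D.n, ¬ D.S u → ¬ D.S v → D.A u v → u < v → l u ≤ l v := by
    intro u hu v hv hSu hSv huv hlt
    obtain ⟨r, hr, hru⟩ := hV.exists_inClique hu hSu
    have hrv : D.InClique r v := by
      refine ⟨hru.1, hSv, ?_, hru.2.2.2⟩
      by_cases e : r = v
      · exact .inl e
      · rcases hru.2.2.1 with rfl | hru'
        · exact .inr huv
        · have ht := hV.2.2.1 u hu r hr hSu hru.1 (hV.2.1 _ hr _ hu hru') v hv (Ne.symm e) huv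
          exact .inr ht
    rw [← hl r hr u hu hru, ← hl r hr v hv hrv]
    refine sum_le_sum fun j _ => ?_
    split_ifs <;> omega
  -- Sort by position or level first, by the index of the vertex second.
  set κ : ℕ → ℕ := fun v => if D.S v then 2 * D.pos a v + 1 else 2 * l v with hκ
  have hlex (u v : Fin D.n) : κ u * D.n + u < κ v * D.n + v ↔
      κ u < κ v ∨ κ u = κ v ∧ (u : ℕ) < v := by
    have hu := u.isLt
    have hv := v.isLt
    rcases lt_trichotomy (κ u) (κ v) with h | h | h
    · have := Nat.mul_le_mul_right D.n (Nat.succ_le_of_lt h)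
      rw [Nat.succ_mul] at this
      exact ⟨fun _ => .inl h, fun _ => by omega⟩
    · rw [h]; omega
    · have := Nat.mul_le_mul_right D.n (Nat.succ_le_of_lt h)
      rw [Nat.succ_mul] at this
      omega
  obtain ⟨σ, hσ⟩ := exists_perm_of_injective (fun v : Fin D.n => κ v * D.n + v) fun u v huv => by
    by_contra hne
    have h₁ := hlex u v
    have h₂ := hlex v u
    have : (u : ℕ) ≠ v := fun e => hne (Fin.ext e)
    simp only at huv
    omega
  refine (ciInf_le' (fun σ => orderingImbalance G σ) σ).trans ?_
  refine (orderingImbalance_eq hA σ a l fun u v hvu => ?_).le.trans ht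
  rw [hσ, hlex]
  have hvu' := (hA v u).2 hvu
  have huv' := (hA u v).2 hvu.symm
  have h₁ := hmono u u.isLt v v.isLt
  have h₂ := hmono v v.isLt u u.isLt
  have hne : (u : ℕ) ≠ v := fun e => hvu.ne (Fin.ext e.symm)
  by_cases hu : D.S u <;> by_cases hv : D.S v <;>
    simp only [hκ, Before, hu, hv, if_true, if_false, not_true_eq_false, not_false_eq_true,
      true_and, false_and, false_or, or_false, huv', hvu', forall_true_left] at h₁ h₂ ⊢ <;> omega

theorem Valid.solvable (hV : D.Valid) (hA : ∀ u v : Fin D.n, D.A u v ↔ G.Adj u v)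
    (hB : D.n * D.n < D.B) (hn : D.n < D.B) (hk : D.k < D.B) : D.Solvable (imbalance G) := by
  classical
  obtain ⟨σ, hσ, hmono⟩ := exists_optimal_ordering G (fun v => D.S v) fun u v hu hv huv w hw huw =>
    (hA v w).1 (hV.2.2.1 u u.isLt v v.isLt hu hv ((hA u v).2 huv) w w.isLt
      (fun e => hw (Fin.ext e)) ((hA u w).2 huw))
  set τ : ℕ → ℕ := fun v => if h : v < D.n then σ ⟨v, h⟩ else 0 with hτ
  have hτσ (v : Fin D.n) : τ v = σ v := by simp [hτ]
  have hτinj : ∀ u < D.n, ∀ v < D.n, τ u = τ v → u = v := fun u hu v hv h => by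
    have h' : (σ ⟨u, hu⟩ : ℕ) = σ ⟨v, hv⟩ := by simpa [hτ, hu, hv] using h
    exact congrArg Fin.val (σ.injective (Fin.ext h'))
  -- The position of a vertex of `S`, and the level of any other vertex.
  set lev : ℕ → ℕ := fun v => #{s ∈ range D.n | D.S s ∧ τ s < τ v} with hlev
  have hlev_mono {u v : ℕ} (h : τ u ≤ τ v) : lev u ≤ lev v :=
    card_le_card fun s hs => by
      rw [mem_filter] at hs ⊢
      exact ⟨hs.1, hs.2.1, hs.2.2.trans_le h⟩
  have hlev_lt {u v : ℕ} (hu : u < D.n) (hS : D.S u) (h : τ u < τ v) : lev u < lev v :=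
    card_lt_card (Finset.ssubset_iff_subset_ne.2 ⟨fun s hs => by
      rw [mem_filter] at hs ⊢
      exact ⟨hs.1, hs.2.1, hs.2.2.trans h⟩, fun e => by
      have : u ∈ {s ∈ range D.n | D.S s ∧ τ s < τ v} := mem_filter.2 ⟨mem_range.2 hu, hS, h⟩
      rw [← e, mem_filter] at this
      exact lt_irrefl _ this.2.2⟩)
  have hlev_k (v : ℕ) : lev v ≤ D.k := by
    refine le_trans ?_ hV.2.2.2
    rw [← card_filter]
    exact card_le_card fun s hs => by
      rw [mem_filter] at hs ⊢
      exact ⟨hs.1, hs.2.1⟩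
  have hlev_B (v : ℕ) : lev v < D.B := (hlev_k v).trans_lt hk
  have hpos {s : ℕ} (hs : s < D.n) (hS : D.S s) : D.pos (D.encode lev) s = lev s :=
    hV.digit_encode hlev_B hs hS
  -- The `j`-th digit for a clique is its first vertex of level greater than `j`.
  set θ : ℕ → ℕ → ℕ := fun r j =>
    if h : ∃ v, v < D.n ∧ D.InClique r v ∧ j < lev v then Nat.find h else D.n with hθ
  have hθ_B (r j : ℕ) : θ r j < D.B := by
    simp only [hθ]
    split_ifs with h
    · exact (Nat.find_spec h).1.trans hn
    · exact hn
  have hθ_iff {r v : ℕ} (hr : r < D.n) (hv : v < D.n) (hrv : D.InClique r v) (j : ℕ) :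
      θ r j ≤ v ↔ j < lev v := by
    constructor
    · intro h
      simp only [hθ] at h
      split_ifs at h with hex
      · obtain ⟨hw, hrw, hj⟩ := Nat.find_spec hex
        rcases h.eq_or_lt with e | hlt
        · exact e ▸ hj
        · have hadj := hV.adj_of_inClique hr hw hv hrw hrv hlt.ne
          have := hmono ⟨_, hw⟩ ⟨v, hv⟩ hrw.2.1 hrv.2.1 ((hA ⟨_, hw⟩ ⟨v, hv⟩).1 hadj) hlt
          refine hj.trans_le (hlev_mono ?_)
          rw [hτσ ⟨_, hw⟩, hτσ ⟨v, hv⟩]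
          exact this.le
      · omega
    · intro h
      have hex : ∃ v, v < D.n ∧ D.InClique r v ∧ j < lev v := ⟨v, hv, hrv, h⟩
      simp only [hθ]
      rw [dif_pos hex]
      exact Nat.find_min' hex ⟨hv, hrv, h⟩
  set f : ℕ → ℕ := fun r => ∑ j ∈ range D.k, θ r j * D.B ^ j with hf
  have hf_lt (r : ℕ) : f r < D.B ^ D.k := sum_mul_pow_lt _ _ fun j _ => hθ_B r j
  have hl : ∀ r < D.n, ∀ v < D.n, D.InClique r v → D.level (f r) v = lev v := by
    intro r hr v hv hrv
    have h (j : ℕ) (hj : j ∈ range D.k) :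
        (if D.digit j (f r) ≤ v then 1 else 0) = if j < lev v then 1 else 0 := by
      rw [digit, sum_mul_pow_div_mod _ _ _ (fun j _ => hθ_B r j) (mem_range.1 hj)]
      simp only [hθ_iff hr hv hrv j]
    rw [level, sum_congr rfl h, ← card_filter]
    have : {j ∈ range D.k | j < lev v} = range (lev v) := by
      ext j
      have := hlev_k v
      simp only [mem_filter, mem_range]
      omega
    rw [this, card_range]
  obtain ⟨hx, htot⟩ := hV.total_eq hB hn (D.encode lev) f lev hl
  refine ⟨D.encode lev, hV.encode_lt hlev_B, _, hx, ?_, ?_⟩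
  · rw [generating_digit_iff hk hn _ _ hx fun f _ => by
      obtain ⟨l, hl⟩ := hV.exists_level f
      exact (hV.total_eq hB hn _ f l hl).1]
    exact ⟨f, hf_lt, rfl⟩
  · rw [htot, ← hσ, orderingImbalance_eq hA σ (D.encode lev) lev fun u v hvu => ?_]
    have hvu' := (hA v u).2 hvu
    have hne : (u : ℕ) ≠ v := fun e => hvu.ne (Fin.ext e.symm)
    have hne' : τ u ≠ τ v := fun e => hne (hτinj u u.isLt v v.isLt e)
    rw [Fin.lt_def, ← hτσ, ← hτσ]
    by_cases hu : D.S u <;> by_cases hv : D.S v <;>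
      simp only [Before, hu, hv, not_true_eq_false, not_false_eq_true, true_and, false_and,
        false_or, or_false]
    · rw [hpos u.isLt hu, hpos v.isLt hv]
      rcases lt_or_gt_of_ne hne' with h | h
      · exact ⟨fun _ => .inl (hlev_lt u.isLt hu h), fun _ => h⟩
      · have := hlev_lt v.isLt hv h
        omega
    · rw [hpos u.isLt hu]
      rcases lt_or_gt_of_ne hne' with h | h
      · exact ⟨fun _ => hlev_lt u.isLt hu h, fun _ => h⟩
      · have := hlev_mono h.le
        omega
    · rw [hpos v.isLt hv]
      rcases lt_or_gt_of_ne hne' with h | h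
      · exact ⟨fun _ => hlev_mono h.le, fun _ => h⟩
      · have := hlev_lt v.isLt hv h
        omega
    · rw [hτσ, hτσ, ← Fin.lt_def]
      constructor
      · intro h
        by_contra hle
        exact lt_asymm h (hmono v u hv hu hvu (Fin.lt_def.2 (by omega)))
      · exact fun h => hmono u v hu hv hvu.symm h

theorem Solvable.mono {t t' : ℕ} (h : D.Solvable t) (hle : t ≤ t') : D.Solvable t' := by
  obtain ⟨a, ha, x, hx, hg, ht⟩ := h
  exact ⟨a, ha, x, hx, hg, ht.trans hle⟩

end Instance

end ImbalanceXP

/-! ### The encoding of instances -/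

namespace ImbalanceXP

open Finset RAM

/-- For a twin cover it is enough to compare adjacent vertices. -/
theorem isTwinCover_iff {V : Type*} (G : SimpleGraph V) (S : Set V) : IsTwinCover G S ↔
    ∀ u v, u ∉ S → v ∉ S → G.Adj u v → ∀ w, w ≠ v → G.Adj u w → G.Adj v w := by
  constructor
  · intro h u v hu hv huv w hw huw
    have hX : (G.induce Sᶜ).Adj ⟨u, hu⟩ ⟨v, hv⟩ := huv
    have := h ((G.induce Sᶜ).connectedComponentMk ⟨u, hu⟩) u ⟨⟨u, hu⟩, rfl, rfl⟩ v
      ⟨⟨v, hv⟩, SimpleGraph.ConnectedComponent.sound hX.reachable.symm, rfl⟩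
    have hw' : w ∈ insert v (G.neighborSet v) := this ▸ Set.mem_insert_of_mem _ huw
    exact hw'.resolve_left hw
  · rintro h X _ ⟨u, hu, rfl⟩ _ ⟨v, hv, rfl⟩
    have hr : (G.induce Sᶜ).Reachable u v :=
      SimpleGraph.ConnectedComponent.exact (hu.trans hv.symm)
    rw [SimpleGraph.reachable_iff_reflTransGen] at hr
    clear hu hv
    have hstep (u v : (Sᶜ : Set V)) (huv : (G.induce Sᶜ).Adj u v) :
        insert (u : V) (G.neighborSet u) ⊆ insert (v : V) (G.neighborSet v) := by
      have huv' : G.Adj u v := huv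
      intro w hw
      by_cases e : w = v
      · exact .inl e
      · rcases hw with rfl | hw
        · exact .inr huv'.symm
        · exact .inr (h u v u.2 v.2 huv' w e hw)
    induction hr with
    | refl => rfl
    | tail _ hbc ih => exact ih.trans ((hstep _ _ hbc).antisymm (hstep _ _ hbc.symm))

theorem numVertices_eq_iff (I : Input) (m : ℕ) :
    numVertices I = m ↔ (∀ i < m, bit I i = true) ∧ bit I m = false := by
  classical
  have hex : ∃ m, bit I m = false := ⟨I.1.length, by simp [bit]⟩
  have hspec := Nat.find_spec hex
  have hlt {i : ℕ} (h : i < Nat.find hex) : bit I i = true := by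
    simpa using Nat.find_min hex h
  have hle : Nat.find hex ≤ I.1.length := Nat.find_min' hex (by simp [bit])
  have h : numVertices I = Nat.find hex := by
    rw [numVertices, ← card_filter]
    have : {i ∈ range I.1.length | ∀ j < I.1.length, j ≤ i → bit I j = true} =
        range (Nat.find hex) := by
      ext i
      simp only [mem_filter, mem_range]
      constructor
      · rintro ⟨hi, h⟩
        by_contra hge
        have := h _ (by omega) (not_lt.1 hge)
        rw [hspec] at this
        cases this
      · exact fun hi => ⟨by omega, fun j _ hj => hlt (by omega)⟩
    rw [this, card_range]
  rw [h]
  constructor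
  · rintro rfl
    exact ⟨fun i => hlt, hspec⟩
  · rintro ⟨h₁, h₂⟩
    refine le_antisymm (Nat.find_min' hex h₂) (not_lt.1 fun h => ?_)
    rw [h₁ _ h] at hspec
    cases hspec

/-- The number with binary digits `l`, the least significant digit first. -/
def ofBits (l : List Bool) : ℕ :=
  ∑ i ∈ range l.length, if l.getD i false = true then 2 ^ i else 0

theorem ofBits_cons (b : Bool) (l : List Bool) : ofBits (b :: l) = b.toNat + 2 * ofBits l := by
  rw [ofBits, List.length_cons, sum_range_succ', ofBits, mul_sum, add_comm]
  congr 1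
  · cases b <;> rfl
  · refine sum_congr rfl fun i _ => ?_
    rw [List.getD_cons_succ]
    split_ifs <;> ring

theorem ofBits_bits (t : ℕ) : ofBits t.bits = t := by
  induction t using Nat.binaryRec' with
  | zero => simp [ofBits]
  | bit b n hb ih =>
    rw [Nat.bits_append_bit n b hb, ofBits_cons, ih, Nat.bit_val]
    omega

theorem bits_last (t : ℕ) : t.bits = [] ∨ t.bits.getD (t.bits.length - 1) false = true := by
  induction t using Nat.binaryRec' with
  | zero => simp
  | bit b n hb ih =>
    rw [Nat.bits_append_bit n b hb]
    cases h : n.bits with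
    | nil =>
      have : n = 0 := by rw [← ofBits_bits n, h]; rfl
      simp [hb this]
    | cons c l =>
      rw [h] at ih
      exact .inr (by simpa using ih)

/-- A word without a trailing `0` is a binary expansion. -/
theorem bits_ofBits (l : List Bool) (hl : l = [] ∨ l.getD (l.length - 1) false = true) :
    (ofBits l).bits = l := by
  induction l with
  | nil => simp [ofBits]
  | cons b l ih =>
    have hl' : l = [] ∨ l.getD (l.length - 1) false = true := by
      cases l with
      | nil => exact .inl rfl
      | cons c l => exact .inr (by simpa using hl)
    have hb : ofBits l = 0 → b = true := by
      intro h
      have := ih hl'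
      rw [h, Nat.zero_bits] at this
      subst this
      simpa using hl
    rw [ofBits_cons, add_comm, ← Nat.bit_val, Nat.bits_append_bit _ _ hb, ih hl']

theorem length_flatMap_finRange {n m : ℕ} (f : Fin m → Fin n → Bool) :
    ((List.finRange m).flatMap fun i => (List.finRange n).map (f i)).length = m * n := by
  simp

theorem getD_flatMap_finRange {n m : ℕ} (f : Fin m → Fin n → Bool) (u : Fin m) (v : Fin n) :
    ((List.finRange m).flatMap fun i => (List.finRange n).map (f i)).getD (u * n + v) false =
      f u v := by
  induction m with
  | zero => exact u.elim0
  | succ m ih =>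
    rw [List.finRange_succ, List.flatMap_cons, List.flatMap_map]
    cases u using Fin.cases with
    | zero =>
      rw [List.getD_append _ _ _ _ (by simp)]
      simp [List.getD_eq_getElem?_getD]
    | succ u =>
      rw [List.getD_append_right _ _ _ _ (by simp [Nat.succ_mul]; omega)]
      have := ih (fun i => f i.succ) u
      rw [← this]
      congr 1
      simp [Nat.succ_mul]
      omega

section

variable {n : ℕ} (G : SimpleGraph (Fin n)) (S : Finset (Fin n)) (t : ℕ)

theorem length_encodeInstance : (encodeInstance G S t).length =
    n + 1 + n * n + n + t.bits.length := by
  simp [encodeInstance]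
  omega

theorem getD_encodeInstance_lt {i : ℕ} (hi : i < n) :
    (encodeInstance G S t).getD i false = true := by
  simp only [encodeInstance, List.append_assoc]
  rw [List.getD_append _ _ _ _ (by simpa using hi)]
  simp [hi]

theorem getD_encodeInstance_self : (encodeInstance G S t).getD n false = false := by
  simp only [encodeInstance, List.append_assoc]
  rw [List.getD_append_right _ _ _ _ (by simp)]
  simp

open Classical in
theorem getD_encodeInstance_adj (u v : Fin n) :
    (encodeInstance G S t).getD (n + 1 + (u * n + v)) false = decide (G.Adj u v) := by
  have h : (u : ℕ) * n + v < n * n := by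
    have := Nat.mul_le_mul_right n (Nat.succ_le_of_lt u.isLt)
    rw [Nat.succ_mul] at this
    have := v.isLt
    omega
  have hlen := length_flatMap_finRange fun u v => decide (G.Adj u v)
  rw [encodeInstance, List.append_assoc, List.append_assoc,
    List.getD_append_right _ _ _ _ (by simp)]
  rw [List.getD_append _ _ _ _ (by rw [hlen]; simp; omega)]
  have e : n + 1 + (u * n + v) - (List.replicate n true ++ [false]).length = u * n + v := by simp
  rw [e]
  exact getD_flatMap_finRange (fun u v => decide (G.Adj u v)) u v

theorem getD_encodeInstance_mem (u : Fin n) :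
    (encodeInstance G S t).getD (n + 1 + n * n + u) false = decide (u ∈ S) := by
  rw [encodeInstance, List.append_assoc, List.getD_append_right _ _ _ _ (by simp; omega),
    List.getD_append _ _ _ _ (by simp; omega)]
  have e (l : List Bool) (hl : l.length = n + 1 + n * n) : n + 1 + n * n + u - l.length = u := by
    omega
  rw [e _ (by simp; omega)]
  simp [List.getD_eq_getElem?_getD]

theorem getD_encodeInstance_target (i : ℕ) :
    (encodeInstance G S t).getD (n + 1 + n * n + n + i) false = t.bits.getD i false := by
  rw [encodeInstance, List.getD_append_right _ _ _ _ (by simp; omega)]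
  congr 1
  simp
  omega

end

theorem target_eq_ofBits {I : Input} (h : headerLength I ≤ I.1.length) :
    target I = ofBits (I.1.drop (headerLength I)) := by
  have h₁ : ∑ i ∈ range (headerLength I),
      (if headerLength I ≤ i ∧ bit I i = true then 2 ^ (i - headerLength I) else 0) = 0 :=
    sum_eq_zero fun i hi => if_neg fun h' => absurd (mem_range.1 hi) (not_lt.2 h'.1)
  have h₂ : I.1.length = headerLength I + (I.1.drop (headerLength I)).length := by
    rw [List.length_drop]; omega
  rw [target, ofBits]
  nth_rw 1 [h₂]
  rw [sum_range_add, h₁, zero_add]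
  refine sum_congr rfl fun i _ => ?_
  simp [bit, List.getD_eq_getElem?_getD]

/-- On a word that presents `G` and `S`, the conditions of the algorithm have the intended
meaning. -/
theorem valid_and_solvable_iff (I : Input) {n : ℕ} (G : SimpleGraph (Fin n)) (S : Finset (Fin n))
    (hn : numVertices I = n) (hlen : headerLength I ≤ I.1.length)
    (hA : ∀ u v : Fin n, (toInstance I).A u v ↔ G.Adj u v)
    (hS : ∀ u : Fin n, (toInstance I).S u ↔ u ∈ S) (t : ℕ) :
    (toInstance I).Valid ∧ (toInstance I).Solvable t ↔
      IsTwinCover G (S : Set (Fin n)) ∧ #S ≤ I.2 ∧ imbalance G ≤ t := by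
  classical
  subst hn
  have hB : (toInstance I).n * (toInstance I).n < (toInstance I).B := by
    change numVertices I * numVertices I < I.1.length + I.2 + 1
    rw [headerLength] at hlen
    omega
  have hnB : (toInstance I).n < (toInstance I).B := by
    change numVertices I < I.1.length + I.2 + 1
    rw [headerLength] at hlen
    omega
  have hk : (toInstance I).k < (toInstance I).B := by
    change I.2 < I.1.length + I.2 + 1
    omega
  have hvalid : (toInstance I).Valid ↔ IsTwinCover G (S : Set (Fin _)) ∧ #S ≤ I.2 := by
    have hcard : ∑ u ∈ range (toInstance I).n, (if (toInstance I).S u then 1 else 0) = #S := by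
      rw [sum_range, ← card_filter]
      congr 1
      ext u
      rw [mem_filter]
      exact (and_iff_right (mem_univ u)).trans (hS u)
    rw [isTwinCover_iff, Instance.Valid, hcard]
    constructor
    · rintro ⟨-, -, ht, hc⟩
      refine ⟨fun u v hu hv huv w hw huw => (hA v w).1 ?_, hc⟩
      exact ht u u.isLt v v.isLt (fun h => hu ((hS u).1 h)) (fun h => hv ((hS v).1 h))
        ((hA u v).2 huv) w w.isLt (fun e => hw (Fin.ext e)) ((hA u w).2 huw)
    · rintro ⟨ht, hc⟩
      refine ⟨fun u hu h => G.loopless.irrefl ⟨u, hu⟩ ((hA ⟨u, hu⟩ ⟨u, hu⟩).1 h),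
        fun u hu v hv h => (hA ⟨v, hv⟩ ⟨u, hu⟩).2 ((hA ⟨u, hu⟩ ⟨v, hv⟩).1 h).symm,
        fun u hu v hv hSu hSv huv w hw hne huw => (hA ⟨v, hv⟩ ⟨w, hw⟩).2 ?_, hc⟩
      exact ht ⟨u, hu⟩ ⟨v, hv⟩ (fun h => hSu ((hS ⟨u, hu⟩).2 h)) (fun h => hSv ((hS ⟨v, hv⟩).2 h))
        ((hA ⟨u, hu⟩ ⟨v, hv⟩).1 huv) ⟨w, hw⟩ (fun e => hne (congrArg Fin.val e))
        ((hA ⟨u, hu⟩ ⟨w, hw⟩).1 huw)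
  rw [← and_assoc, ← hvalid]
  exact and_congr_right fun hV => ⟨fun h => hV.imbalance_le hA hB hnB hk h,
    fun h => (hV.solvable hA hB hnB hk).mono h⟩

theorem mem_imbalanceTwinCover_iff (I : Input) : I ∈ ImbalanceTwinCover ↔ Accepts I := by
  classical
  constructor
  · rintro ⟨n, G, S, t, hx, hcover, hcard, ht⟩
    have hn : numVertices I = n := (numVertices_eq_iff I n).2
      ⟨fun i hi => by rw [bit, hx]; exact getD_encodeInstance_lt G S t hi,
        by rw [bit, hx]; exact getD_encodeInstance_self G S t⟩
    have hh : headerLength I = n + 1 + n * n + n := by rw [headerLength, hn]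
    have hlen : I.1.length = headerLength I + t.bits.length := by
      rw [hx, length_encodeInstance, hh]
    have htgt (i : ℕ) : bit I (headerLength I + i) = t.bits.getD i false := by
      rw [bit, hx, hh, getD_encodeInstance_target]
    have hdrop : I.1.drop (headerLength I) = t.bits := by
      rw [hx, hh, encodeInstance]
      exact List.drop_left' (by simp; omega)
    have htarget : target I = t := by
      rw [target_eq_ofBits (by omega), hdrop, ofBits_bits]
    refine ⟨by omega, ?_, (valid_and_solvable_iff I G S hn (by omega) (fun u v => ?_)
      (fun u => ?_) _).2 ⟨hcover, hcard, htarget.symm ▸ ht⟩⟩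
    · rcases bits_last t with h | h
      · rw [h] at hlen
        exact .inl hlen
      · right
        have hpos : t.bits.length ≠ 0 := fun h0 => by
          rw [List.eq_nil_of_length_eq_zero h0] at h
          cases h
        rw [← h, ← htgt]
        congr 1
        omega
    · change bit I (numVertices I + 1 + (u * numVertices I + v)) = true ↔ _
      rw [hn, bit, hx, getD_encodeInstance_adj, decide_eq_true_iff]
    · change bit I (numVertices I + 1 + numVertices I * numVertices I + u) = true ↔ _
      rw [hn, bit, hx, getD_encodeInstance_mem, decide_eq_true_iff]
  · rintro ⟨hlen, hlast, hVS⟩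
    obtain ⟨h₁, h₂⟩ := (numVertices_eq_iff I _).1 rfl
    set n := numVertices I with hn
    have hh : headerLength I = n + 1 + n * n + n := rfl
    have hV := hVS.1
    let G : SimpleGraph (Fin n) :=
      { Adj := fun u v => (toInstance I).A u v
        symm := ⟨fun u v h => hV.2.1 u u.isLt v v.isLt h⟩
        loopless := ⟨fun u h => hV.1 u u.isLt h⟩ }
    let S : Finset (Fin n) := {u | (toInstance I).S u}
    have hS (u : Fin n) : (toInstance I).S u ↔ u ∈ S := by simp [S]
    obtain ⟨hcover, hcard, ht⟩ := (valid_and_solvable_iff I G S rfl hlen (fun _ _ => Iff.rfl) hS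
      _).1 hVS
    refine ⟨n, G, S, target I, ?_, hcover, hcard, ht⟩
    have hbits : (target I).bits = I.1.drop (headerLength I) := by
      rw [target_eq_ofBits hlen, bits_ofBits]
      rcases hlast with h | h
      · exact .inl (List.drop_of_length_le h.le)
      · rcases hlen.eq_or_lt with h' | h'
        · exact .inl (List.drop_of_length_le h'.ge)
        · right
          rw [← h, List.length_drop, bit, List.getD_eq_getElem?_getD, List.getElem?_drop,
            List.getD_eq_getElem?_getD]
          congr 2
          omega
    have hlength : (encodeInstance G S (target I)).length = I.1.length := by
      rw [length_encodeInstance, hbits, List.length_drop]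
      omega
    have hget (i : ℕ) : I.1.getD i false = (encodeInstance G S (target I)).getD i false := by
      rcases lt_trichotomy i n with hi | rfl | hi
      · rw [getD_encodeInstance_lt G S _ hi]; exact h₁ i hi
      · rw [getD_encodeInstance_self]; exact h₂
      by_cases hi₂ : i < n + 1 + n * n
      · have hn0 : 0 < n := by
          rcases Nat.eq_zero_or_pos n with h | h
          · rw [h] at hi₂ hi; omega
          · exact h
        obtain ⟨j, rfl⟩ : ∃ j, i = n + 1 + j := ⟨i - (n + 1), by omega⟩
        have hj : j < n * n := by omega
        have := getD_encodeInstance_adj G S (target I) ⟨j / n, Nat.div_lt_of_lt_mul hj⟩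
          ⟨j % n, Nat.mod_lt _ hn0⟩
        simp only [Nat.div_add_mod'] at this
        rw [this, Bool.eq_iff_iff, decide_eq_true_iff]
        change _ ↔ bit I (n + 1 + (j / n * n + j % n)) = true
        rw [Nat.div_add_mod']
      by_cases hi₃ : i < n + 1 + n * n + n
      · obtain ⟨j, rfl⟩ : ∃ j, i = n + 1 + n * n + j := ⟨i - (n + 1 + n * n), by omega⟩
        have := getD_encodeInstance_mem G S (target I) ⟨j, by omega⟩
        simp only at this
        rw [this, Bool.eq_iff_iff, decide_eq_true_iff, ← hS]
        rfl
      · obtain ⟨j, rfl⟩ : ∃ j, i = n + 1 + n * n + n + j :=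
          ⟨i - (n + 1 + n * n + n), by omega⟩
        rw [getD_encodeInstance_target, hbits, ← hh]
        simp [List.getD_eq_getElem?_getD]
    refine List.ext_getElem hlength.symm fun i hi hi' => ?_
    have := hget i
    rwa [List.getD_eq_getElem _ _ hi, List.getD_eq_getElem _ _ hi'] at this

end ImbalanceXP

theorem theorem2 : InXP ImbalanceTwinCover := by
  have h : ImbalanceTwinCover = {I | ImbalanceXP.Accepts I} :=
    Set.ext ImbalanceXP.mem_imbalanceTwinCover_iff
  rw [h]
  exact (ImbalanceXP.cmpP_accepts (c := RAM.Ctx.root ImbalanceXP.rounds)).inXP
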